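/- **Setting.** Let $(X,\mathfrak A,P)$ and $(Y,\mathfrak B,Q)$ be probability spaces and let $R$ be a probability measure on $\mathfrak A\otimes\mathfrak B$ with marginals $P$ and $Q$. For a measure $T$ write $\widehat T$ for its completion, and for $E\subset X\times Y$ write $E^y=\{x:(x,y)\in E\}$. Let $\mathbb S=\{(\mathfrak A_y,S_y):y\in Y\}$ be a $Q$-disintegration of $R$: each $\mathfrak A_y\subset\mathfrak A$ is a $\sigma$-algebra and $S_y$ is a probability measure on $\mathfrak A_y$; for each $A\in\mathfrak A$ there is $N\in\mathfrak B$ with $Q(N)=0$ such that $A\in\mathfrak A_y$ for all $y\notin N$ and $y\mapsto S_y(A)$ is $\mathfrak B$-measurable on $Y\setminus N$; and $\int_B S_y(A)\,dQ(y)=R(A\times B)$ for all $A\in\mathfrak A$, $B\in\mathfrak B$. Let $\mathfrak C\subset\bigcap_{y}\mathfrak A_y$ be a $\sigma$-algebra such that $P$ and every $S_y$ are inner regular with respect to $\mathfrak C$ (every measurable $A$ contains, for each $\varepsilon>0$, some $D\in\mathfrak C$ such that $A\setminus D$ has measure less than $\varepsilon$). **Densities.** A (lower) density on a probability space $(Z,\mathfrak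 Z,T)$ is a map $\delta:\mathfrak Z\to\mathfrak Z$ with $\delta(\emptyset)=\emptyset$, $\delta(Z)=Z$, $\delta(A\cap B)=\delta(A)\cap\delta(B)$, $T(\delta(A)\triangle A)=0$, and $\delta(A)=\delta(B)$ whenever $T(A\triangle B)=0$. **Equi-admissible families.** Let $\{M_\alpha:\alpha<\kappa\}$, $\kappa>0$, generate $\mathfrak C$, with $M_0=\emptyset$ and $M_\beta\notin\sigma(\{M_\delta:\delta<\alpha\})$ for $\alpha<\beta<\kappa$, where $\kappa$ is the least ordinal for which such a sequence exists. For each limit ordinal $\gamma\le\kappa$ of countable cofinality fix a strictly increasing sequence $(\gamma_n)$ of nonzero ordinals cofinal in $\gamma$. For each $y$ let $\tau_y$ be a density on $(X,\mathfrak C,T)$, $T=S_y|_{\mathfrak C}$, such that, with $\mathfrak Z_\gamma=\sigma(\{M_\alpha:\alpha<\gamma\}\cup\{C\in\mathfrak C:T(C)=0\})$, we have $\tau_y=t_\kappa$ for maps $t_\gamma$ on $\mathfrak Z_\gamma$, $0<\gamma\le\kappa$, satisfying: - $t_1(B)=\emptyset$ if $T(B)=0$ and $t_1(B)=X$ otherwise;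 - if $\gamma$ is a limit of uncountable cofinality, $t_\gamma(B)=t_\alpha(B)$ for $B\in\mathfrak Z_\alpha$, $0<\alpha<\gamma$; - if $\gamma$ is a limit of countable cofinality, $t_\gamma(B)=\bigcap_{k}\bigcup_{n}\bigcap_{m\ge n}t_{\gamma_m}(\{\mathbb E(\chi_B\mid\mathfrak Z_{\gamma_m})>1-2^{-k}\})$; - if $\gamma=\beta+1$ with $\beta>0$, then for some $\mathfrak Z_\beta$-envelopes $F_1\supset M_\beta$ and $F_2\supset M_\beta^c$ and all $G,H\in\mathfrak Z_\beta$, $$t_\gamma\bigl((G\cap M_\beta)\cup(H\cap M_\beta^c)\bigr)=\bigl[M_\beta\cap t_\beta((G\cap F_1)\cup(H\cap F_1^c))\bigr]\cup\bigl[M_\beta^c\cap t_\beta((H\cap F_2)\cup(G\cap F_2^c))\bigr].$$ By inner regularity $\tau_y$ extends uniquely to $\widehat{\mathfrak A_y}$: the extension, again denoted $\tau_y$, is $\tau_y(A)=\tau_y(C)$ for any $C\in\mathfrak C$ with $\widehat{S_y}(A\triangle C)=0$. **Enlarged products.** Let $\mathcal M$ be the family of all $E\subset X\times Y$ for which there is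 $N\in\mathfrak B$ with $Q(N)=0$ and $\widehat{S_y}(E^y)=0$ for all $y\notin N$, and let $\widehat{\mathcal N}$ be the family of those $E\in\mathcal M$ with $E^y\in\widehat{\mathfrak A_y}$ for all $y\in Y$. Put $\mathfrak A\odot\mathfrak B=\{W\triangle N:W\in\mathfrak A\otimes\mathfrak B,\ N\in\mathcal M\}$, with the measure $\widehat{R_\odot}(V)=\int_Y\widehat{S_y}(V^y)\,dQ(y)$ extending $R$, and $\mathfrak C\odot_{\widehat{\mathbb S}}\mathfrak B=\{W\triangle N:W\in\mathfrak C\otimes\mathfrak B,\ N\in\widehat{\mathcal N}\}$. **Proposition.** There exists a density $\psi$ on $(X\times Y,\mathfrak A\odot\mathfrak B,\widehat{R_\odot})$ with all its values in $\mathfrak C\odot_{\widehat{\mathbb S}}\mathfrak B$ such that for all $E\in\mathfrak A\odot\mathfrak B$ and all $y\in Y$: 1. $\widehat{S_y}\bigl([\psi(E)]^y\cup[\psi(E^c)]^y\bigr)=1$; 2. $[\psi(E)]^y=\tau_y\bigl([\psi(E)]^y\bigr)$. -/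

import Mathlib

open Set MeasureTheory
open scoped symmDiff ENNReal Cardinal

universe u v

/-- The section `E^y = {x | (x, y) ∈ E}`. -/
def sec {X : Type u} {Y : Type v} (E : Set (X × Y)) (y : Y) : Set X := {x | (x, y) ∈ E}

/-- `R ∈ P ∘ Q`: the (probability) measure `R` on the product σ-algebra has marginals `P` and `Q`. -/
def IsSkewProduct {X : Type u} {Y : Type v} [MeasurableSpace X] [MeasurableSpace Y]
    (P : Measure X) (Q : Measure Y) (R : Measure (X × Y)) : Prop :=
  R.fst = P ∧ R.snd = Q

/-- `{(𝔄y y, S y) : y ∈ Y}` is a `Q`-disintegration of `R`. -/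
structure IsDisintegration {X : Type u} {Y : Type v} [𝔄 : MeasurableSpace X] [MeasurableSpace Y]
    (Q : Measure Y) (R : Measure (X × Y))
    (𝔄y : Y → MeasurableSpace X) (S : ∀ y, @Measure X (𝔄y y)) : Prop where
  le : ∀ y, 𝔄y y ≤ 𝔄
  prob : ∀ y, S y univ = 1
  dis1 : ∀ A : Set X, MeasurableSet A → ∃ N : Set Y, MeasurableSet N ∧ Q N = 0 ∧
    (∀ y ∉ N, MeasurableSet[𝔄y y] A) ∧ Measurable (Nᶜ.domRestrict fun y => S y A)
  dis2 : ∀ (A : Set X) (B : Set Y), MeasurableSet A → MeasurableSet B →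
    ∫⁻ y in B, S y A ∂Q = R (A ×ˢ B)

/-- `T` is inner regular with respect to (the members of) the σ-algebra `𝔇`. -/
def IsInnerRegularWrt {Z : Type u} {𝔷 : MeasurableSpace Z} (T : Measure Z)
    (𝔇 : MeasurableSpace Z) : Prop :=
  ∀ A : Set Z, MeasurableSet[𝔷] A → ∀ ε : ℝ≥0∞, 0 < ε →
    ∃ D : Set Z, MeasurableSet[𝔇] D ∧ D ⊆ A ∧ T (A \ D) < ε

/-- `δ` is a lower density on the measure space `(Z, T)`. Only the values of `δ` on measurable sets
matter. -/
structure IsLowerDensity {Z : Type*} {𝔷 : MeasurableSpace Z} (T : Measure Z)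
    (δ : Set Z → Set Z) : Prop where
  measurable : ∀ A, MeasurableSet A → MeasurableSet (δ A)
  empty : δ ∅ = ∅
  univ : δ univ = univ
  inter : ∀ A B, MeasurableSet A → MeasurableSet B → δ (A ∩ B) = δ A ∩ δ B
  equiv : ∀ A, MeasurableSet A → T (δ A ∆ A) = 0
  congr : ∀ A B, MeasurableSet A → MeasurableSet B → T (A ∆ B) = 0 → δ A = δ B

/-! ### Admissible densities -/

/-- `M_α`, `α < κ`, starts with `∅`, generates `𝔆`, and `M_β ∉ σ {M_δ : δ < α}` for `α < β`. -/
structure IsGeneratingSequence {X : Type u} (𝔆 : MeasurableSpace X) (κ : Ordinal.{u})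
    (M : Ordinal.{u} → Set X) : Prop where
  pos : 0 < κ
  zero : M 0 = ∅
  generates : MeasurableSpace.generateFrom (M '' Iio κ) = 𝔆
  notMem : ∀ α β, α < β → β < κ →
    ¬ MeasurableSet[MeasurableSpace.generateFrom (M '' Iio α)] (M β)

/-- A generating sequence of the least possible length. -/
def IsMinimalGeneratingSequence {X : Type u} (𝔆 : MeasurableSpace X) (κ : Ordinal.{u})
    (M : Ordinal.{u} → Set X) : Prop :=
  IsGeneratingSequence 𝔆 κ M ∧ ∀ κ' M', IsGeneratingSequence 𝔆 κ' M' → κ ≤ κ'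

/-- For each limit ordinal `γ ≤ κ` of countable cofinality, `s γ` is an increasing sequence of
nonzero ordinals cofinal with `γ`. -/
def IsCofinalSystem (κ : Ordinal.{u}) (s : Ordinal.{u} → ℕ → Ordinal.{u}) : Prop :=
  ∀ γ ≤ κ, Order.IsSuccLimit γ → γ.cof = ℵ₀ →
    StrictMono (s γ) ∧ (∀ n, 0 < s γ n ∧ s γ n < γ) ∧ ∀ α < γ, ∃ n, α < s γ n

/-- `𝔷_γ`, generated by the `M_α`, `α < γ`, and the measurable `T`-null sets. -/
abbrev stage {Z : Type u} {𝔷 : MeasurableSpace Z} (T : Measure Z) (M : Ordinal.{u} → Set Z)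
    (γ : Ordinal.{u}) : MeasurableSpace Z :=
  MeasurableSpace.generateFrom (M '' Iio γ ∪ {A | MeasurableSet[𝔷] A ∧ T A = 0})

/-- `F` is an `𝔇`-envelope of `A`. -/
def IsEnvelope {Z : Type u} {𝔷 : MeasurableSpace Z} (T : Measure Z) (𝔇 : MeasurableSpace Z)
    (A F : Set Z) : Prop :=
  MeasurableSet[𝔇] F ∧ A ⊆ F ∧ ∀ D, MeasurableSet[𝔇] D → D ⊆ F \ A → T D = 0

/-- The maps `t γ` (relevant on `stage T M γ`, for `0 < γ ≤ κ`) arise by the transfinite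
construction along `M` and the cofinal sequences `s`. -/
structure IsAdmissibleConstruction {Z : Type u} {𝔷 : MeasurableSpace Z} (T : Measure Z)
    (κ : Ordinal.{u}) (M : Ordinal.{u} → Set Z) (s : Ordinal.{u} → ℕ → Ordinal.{u})
    (t : Ordinal.{u} → Set Z → Set Z) : Prop where
  one_null : ∀ B, MeasurableSet[stage T M 1] B → T B = 0 → t 1 B = ∅
  one_not_null : ∀ B, MeasurableSet[stage T M 1] B → T B ≠ 0 → t 1 B = univ
  limit_uncountable : ∀ γ ≤ κ, Order.IsSuccLimit γ → ℵ₀ < γ.cof →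
    ∀ α, 0 < α → α < γ → ∀ B, MeasurableSet[stage T M α] B → t γ B = t α B
  limit_countable : ∀ γ ≤ κ, Order.IsSuccLimit γ → γ.cof = ℵ₀ →
    ∀ B, MeasurableSet[stage T M γ] B →
      t γ B = ⋂ k : ℕ, ⋃ n : ℕ, ⋂ m : ℕ, ⋂ _ : n ≤ m,
        t (s γ m) {z | 1 - (2 : ℝ)⁻¹ ^ k <
          condExp (stage T M (s γ m)) T (B.indicator fun _ => (1 : ℝ)) z}
  succ : ∀ β, 0 < β → Order.succ β ≤ κ →
    ∃ F₁ F₂, IsEnvelope T (stage T M β) (M β) F₁ ∧ IsEnvelope T (stage T M β) (M β)ᶜ F₂ ∧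
      ∀ G H, MeasurableSet[stage T M β] G → MeasurableSet[stage T M β] H →
        t (Order.succ β) (G ∩ M β ∪ H ∩ (M β)ᶜ) =
          (M β ∩ t β (G ∩ F₁ ∪ H ∩ F₁ᶜ)) ∪ ((M β)ᶜ ∩ t β (H ∩ F₂ ∪ G ∩ F₂ᶜ))

/-- `τ` is a density on `(Z, T)` which is the final map `t κ` of a transfinite construction along
`M` and `s`. -/
def IsAdmissibleDensity {Z : Type u} {𝔷 : MeasurableSpace Z} (T : Measure Z)
    (κ : Ordinal.{u}) (M : Ordinal.{u} → Set Z) (s : Ordinal.{u} → ℕ → Ordinal.{u})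
    (τ : Set Z → Set Z) : Prop :=
  IsLowerDensity T τ ∧ ∃ t, IsAdmissibleConstruction T κ M s t ∧
    ∀ E, MeasurableSet[𝔷] E → τ E = t κ E

/-- `{τ y : y ∈ Y}` is an equi-admissible family of densities on `𝔆` determined by
`{M α : α < κ}`: the sequence `M` and the cofinal sequences are common to all `y`, and the measure
for the index `y` is the restriction of `S y` to `𝔆`. -/
def IsEquiAdmissible {X : Type u} {Y : Type v} (𝔄y : Y → MeasurableSpace X)
    (S : ∀ y, @Measure X (𝔄y y)) (𝔆 : MeasurableSpace X) (h𝔆 : ∀ y, 𝔆 ≤ 𝔄y y)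
    (κ : Ordinal.{u}) (M : Ordinal.{u} → Set X) (τ : Y → Set X → Set X) : Prop :=
  IsMinimalGeneratingSequence 𝔆 κ M ∧ ∃ s, IsCofinalSystem κ s ∧
    ∀ y, IsAdmissibleDensity ((S y).trim (h𝔆 y)) κ M s (τ y)

/-- The extension of a density `τ` on `𝔆` to sets `A` that agree up to a `T`-null set with some
`C ∈ 𝔆`: its value is `τ C`, which is the same for all such `C`. -/
def extendDensity {X : Type u} {𝔷 : MeasurableSpace X} (T : Measure X) (𝔆 : MeasurableSpace X)
    (τ : Set X → Set X) (A : Set X) : Set X :=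
  {x | ∃ C, MeasurableSet[𝔆] C ∧ T (A ∆ C) = 0 ∧ x ∈ τ C}

/-! ### The enlarged product σ-algebras and the extended measure

A Mathlib measure is defined on all sets through its outer measure, so that `S y A = 0` says that
`A` is null for the completion of `S y`, and `S y A` is the value of the completion at each
`A` with `NullMeasurableSet A (S y)`. -/

/-- The left nil sets `𝓜`. -/
def leftNil {X : Type u} {Y : Type v} [MeasurableSpace Y] (Q : Measure Y)
    (𝔄y : Y → MeasurableSpace X) (S : ∀ y, @Measure X (𝔄y y)) : Set (Set (X × Y)) :=
  {E | ∃ N, MeasurableSet N ∧ Q N = 0 ∧ ∀ y ∉ N, S y (sec E y) = 0}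

/-- The left nil sets all of whose sections are measurable for the completions. -/
def leftNilHat {X : Type u} {Y : Type v} [MeasurableSpace Y] (Q : Measure Y)
    (𝔄y : Y → MeasurableSpace X) (S : ∀ y, @Measure X (𝔄y y)) : Set (Set (X × Y)) :=
  {E | (∀ y, @NullMeasurableSet X (𝔄y y) (sec E y) (S y)) ∧
    ∃ N, MeasurableSet N ∧ Q N = 0 ∧ ∀ y ∉ N, S y (sec E y) = 0}

/-- The family `{W ∆ N : W ∈ 𝔆 ⊗ 𝔅, N ∈ leftNilHat}`. -/
def smallSets {X : Type u} {Y : Type v} [𝔅 : MeasurableSpace Y] (𝔆 : MeasurableSpace X)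
    (Q : Measure Y) (𝔄y : Y → MeasurableSpace X) (S : ∀ y, @Measure X (𝔄y y)) :
    Set (Set (X × Y)) :=
  {V | ∃ W N, MeasurableSet[𝔆.prod 𝔅] W ∧ N ∈ leftNilHat Q 𝔄y S ∧ V = W ∆ N}

theorem leftNil_mono {X : Type u} {Y : Type v} [MeasurableSpace Y] {Q : Measure Y}
    {𝔄y : Y → MeasurableSpace X} {S : ∀ y, @Measure X (𝔄y y)} {E F : Set (X × Y)}
    (hF : F ∈ leftNil Q 𝔄y S) (h : E ⊆ F) : E ∈ leftNil Q 𝔄y S := by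
  obtain ⟨N, hN, hQ, h0⟩ := hF
  exact ⟨N, hN, hQ, fun y hy => measure_mono_null (fun x hx => h hx) (h0 y hy)⟩

theorem leftNil_iUnion {X : Type u} {Y : Type v} [MeasurableSpace Y] {Q : Measure Y}
    {𝔄y : Y → MeasurableSpace X} {S : ∀ y, @Measure X (𝔄y y)} {E : ℕ → Set (X × Y)}
    (hE : ∀ n, E n ∈ leftNil Q 𝔄y S) : (⋃ n, E n) ∈ leftNil Q 𝔄y S := by
  choose N hN hQ h0 using hE
  refine ⟨⋃ n, N n, MeasurableSet.iUnion hN, measure_iUnion_null hQ, fun y hy => ?_⟩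
  have hs : sec (⋃ n, E n) y = ⋃ n, sec (E n) y := by ext x; simp [sec]
  rw [hs]
  refine measure_iUnion_null fun n => h0 n y fun hn => hy (mem_iUnion.2 ⟨n, hn⟩)

/-- The σ-algebra `𝔄 ⊙ 𝔅 = {W ∆ N : W ∈ 𝔄 ⊗ 𝔅, N ∈ leftNil}`. -/
abbrev bigSpace {X : Type u} {Y : Type v} (𝔄 : MeasurableSpace X) [𝔅 : MeasurableSpace Y]
    (Q : Measure Y) (𝔄y : Y → MeasurableSpace X) (S : ∀ y, @Measure X (𝔄y y)) : MeasurableSpace (X × Y) where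
  MeasurableSet' V := ∃ W N : Set (X × Y), MeasurableSet[𝔄.prod 𝔅] W ∧ N ∈ leftNil Q 𝔄y S ∧ V = W ∆ N
  measurableSet_empty :=
    ⟨∅, ∅, MeasurableSet.empty, ⟨∅, MeasurableSet.empty, measure_empty, fun y _ => by
      simp [sec]⟩, by simp⟩
  measurableSet_compl := by
    rintro V ⟨W, N, hW, hN, rfl⟩
    refine ⟨Wᶜ, N, hW.compl, hN, ?_⟩
    ext z
    simp only [mem_compl_iff, mem_symmDiff]
    tauto
  measurableSet_iUnion := by
    intro V hV
    choose W N hW hN hVW using hV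
    refine ⟨⋃ n, W n, (⋃ n, W n) ∆ ⋃ n, V n, MeasurableSet.iUnion hW, ?_, by simp⟩
    refine leftNil_mono (leftNil_iUnion hN) ?_
    intro z hz
    simp only [mem_symmDiff, mem_iUnion, hVW, not_exists] at hz ⊢
    rcases hz with ⟨⟨n, hn⟩, h⟩ | ⟨⟨n, hn⟩, h⟩
    · exact ⟨n, by have := h n; tauto⟩
    · exact ⟨n, by have := h n; tauto⟩

theorem IsDisintegration.sec_prod {X : Type u} {Y : Type v} {𝔄 : MeasurableSpace X}
    [MeasurableSpace Y] {Q : Measure Y} {R : Measure (X × Y)} {𝔄y : Y → MeasurableSpace X}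
    {S : ∀ y, @Measure X (𝔄y y)} (h : IsDisintegration Q R 𝔄y S) {W : Set (X × Y)}
    (hW : MeasurableSet W) :
    (∀ᵐ y ∂Q, MeasurableSet[𝔄y y] (sec W y)) ∧ AEMeasurable (fun y => S y (sec W y)) Q := by
  refine MeasurableSpace.induction_on_inter
    (C := fun W _ => (∀ᵐ y ∂Q, MeasurableSet[𝔄y y] (sec W y)) ∧
      AEMeasurable (fun y => S y (sec W y)) Q)
    generateFrom_prod.symm isPiSystem_prod ?_ ?_ ?_ ?_ W hW
  · simp [sec]
  · rintro _ ⟨A, hA, B, hB, rfl⟩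
    obtain ⟨N, hN, hQ, h1, h2⟩ := h.dis1 A hA
    have hA' : AEMeasurable (fun y => S y A) Q := by
      have h3 : AEMeasurable (fun y => S y A) (Q.restrict Nᶜ) := by
        have : Measurable (fun y : (Nᶜ : Set Y) => S y A) := h2
        exact (aemeasurable_restrict_iff_comap_subtype hN.compl).2 this.aemeasurable
      have h4 : Q.restrict Nᶜ = Q :=
        Measure.restrict_eq_self_of_ae_mem (measure_eq_zero_iff_ae_notMem.1 hQ)
      rwa [h4] at h3
    have hsec : ∀ y, sec (A ×ˢ B) y = {x ∈ A | y ∈ B} := by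
      intro y; rfl
    refine ⟨?_, ?_⟩
    · filter_upwards [measure_eq_zero_iff_ae_notMem.1 hQ] with y hy
      rw [hsec]
      by_cases hB : y ∈ B
      · simpa [hB] using h1 y hy
      · simp [hB]
    · have : (fun y => S y (sec (A ×ˢ B) y)) = B.indicator fun y => S y A := by
        funext y
        rw [hsec]
        by_cases hy : y ∈ B <;> simp [hy]
      rw [this]
      exact hA'.indicator hB
  · rintro W _ ⟨h1, h2⟩
    have hs : ∀ y, sec Wᶜ y = (sec W y)ᶜ := fun y => rfl
    refine ⟨?_, ?_⟩
    · filter_upwards [h1] with y hy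
      rw [hs]
      exact @MeasurableSet.compl _ _ (𝔄y y) hy
    · refine AEMeasurable.congr (f := fun y => 1 - S y (sec W y)) (h2.const_sub 1) ?_
      filter_upwards [h1] with y hy
      have hfin : S y (sec W y) ≠ ∞ :=
        ne_top_of_le_ne_top (by rw [h.prob y]; exact ENNReal.one_ne_top)
          (measure_mono (subset_univ _))
      rw [hs, measure_compl hy hfin, h.prob y]
  · intro f hd _ hf
    have hs : ∀ y, sec (⋃ n, f n) y = ⋃ n, sec (f n) y := by
      intro y; ext x; simp [sec]
    have hae : ∀ᵐ y ∂Q, ∀ n, MeasurableSet[𝔄y y] (sec (f n) y) :=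
      ae_all_iff.2 fun n => (hf n).1
    refine ⟨?_, ?_⟩
    · filter_upwards [hae] with y hy
      rw [hs]
      exact @MeasurableSet.iUnion _ _ (𝔄y y) _ _ hy
    · refine AEMeasurable.congr (f := fun y => ∑' n, S y (sec (f n) y))
        (AEMeasurable.tsum fun n => (hf n).2) ?_
      filter_upwards [hae] with y hy
      rw [hs, measure_iUnion (fun i j hij => ?_) hy]
      exact Set.disjoint_left.2 fun x hx hx' => Set.disjoint_left.1 (hd hij) hx hx'

theorem IsDisintegration.sec_big {X : Type u} {Y : Type v} {𝔄 : MeasurableSpace X}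
    [MeasurableSpace Y] {Q : Measure Y} {R : Measure (X × Y)} {𝔄y : Y → MeasurableSpace X}
    {S : ∀ y, @Measure X (𝔄y y)} (h : IsDisintegration Q R 𝔄y S) {V : Set (X × Y)}
    (hV : MeasurableSet[bigSpace 𝔄 Q 𝔄y S] V) :
    (∀ᵐ y ∂Q, @NullMeasurableSet X (𝔄y y) (sec V y) (S y)) ∧ AEMeasurable (fun y => S y (sec V y)) Q := by
  obtain ⟨W, N, hW, ⟨N', hN', hQ, h0⟩, rfl⟩ := hV
  obtain ⟨h1, h2⟩ := h.sec_prod hW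
  have hae : ∀ᵐ y ∂Q, sec W y =ᵐ[S y] sec (W ∆ N) y := by
    filter_upwards [measure_eq_zero_iff_ae_notMem.1 hQ] with y hy
    refine measure_symmDiff_eq_zero_iff.1 (measure_mono_null ?_ (h0 y hy))
    intro x hx
    simp only [sec, mem_symmDiff, mem_ofPred_eq] at hx ⊢
    tauto
  refine ⟨?_, h2.congr ?_⟩
  · filter_upwards [hae, h1] with y hy hy1
    exact (MeasurableSet.nullMeasurableSet hy1).congr hy
  · filter_upwards [hae] with y hy
    exact measure_congr hy

/-- The extension of `R` to `𝔄 ⊙ 𝔅`, given by `V ↦ ∫ S_y(V^y) dQ(y)`. -/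
noncomputable def bigMeasure {X : Type u} {Y : Type v} {𝔄 : MeasurableSpace X}
    [MeasurableSpace Y] {Q : Measure Y} {R : Measure (X × Y)} {𝔄y : Y → MeasurableSpace X}
    {S : ∀ y, @Measure X (𝔄y y)} (h : IsDisintegration Q R 𝔄y S) :
    @Measure (X × Y) (bigSpace 𝔄 Q 𝔄y S) :=
  @Measure.ofMeasurable _ (bigSpace 𝔄 Q 𝔄y S) (fun V _ => ∫⁻ y, S y (sec V y) ∂Q)
    (by simp [sec])
    (by
      intro f hf hd
      rw [← lintegral_tsum fun n => (h.sec_big (hf n)).2]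
      refine lintegral_congr_ae ?_
      filter_upwards [ae_all_iff.2 fun n => (h.sec_big (hf n)).1] with y hy
      have hs : sec (⋃ n, f n) y = ⋃ n, sec (f n) y := by ext x; simp [sec]
      rw [hs, measure_iUnion₀ (fun i j hij => ?_) hy]
      exact Disjoint.aedisjoint
        (Set.disjoint_left.2 fun x hx hx' => Set.disjoint_left.1 (hd hij) hx hx'))

/-! ### Existence of lower densities on arbitrary probability spaces -/

/-- A lower density defined on a sub-σ-algebra which contains all the measurable null sets. -/
structure PartialDensity {Z : Type*} {𝔷 : MeasurableSpace Z} (T : Measure Z) where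
  /-- The domain of the density. -/
  space : MeasurableSpace Z
  le : space ≤ 𝔷
  null : ∀ A, MeasurableSet[𝔷] A → T A = 0 → MeasurableSet[space] A
  /-- The density, relevant on `space` only. -/
  toFun : Set Z → Set Z
  measurable : ∀ A, MeasurableSet[space] A → MeasurableSet[𝔷] (toFun A)
  empty : toFun ∅ = ∅
  univ : toFun univ = univ
  inter : ∀ A B, MeasurableSet[space] A → MeasurableSet[space] B →
    toFun (A ∩ B) = toFun A ∩ toFun B
  equiv : ∀ A, MeasurableSet[space] A → toFun A =ᵐ[T] A
  congr : ∀ A B, MeasurableSet[space] A → MeasurableSet[space] B → A =ᵐ[T] B → toFun A = toFun B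

namespace PartialDensity

variable {Z : Type*} {𝔷 : MeasurableSpace Z} {T : Measure Z}

instance : Preorder (PartialDensity T) where
  le d e := d.space ≤ e.space ∧ ∀ A, MeasurableSet[d.space] A → e.toFun A = d.toFun A
  le_refl d := ⟨le_rfl, fun _ _ => rfl⟩
  le_trans d e f h h' := ⟨h.1.trans h'.1, fun A hA => (h'.2 A (h.1 A hA)).trans (h.2 A hA)⟩

theorem mono (d : PartialDensity T) {A B : Set Z} (hA : MeasurableSet[d.space] A)
    (hB : MeasurableSet[d.space] B) (h : A ≤ᵐ[T] B) : d.toFun A ⊆ d.toFun B := by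
  have h1 : (A ∩ B : Set Z) =ᵐ[T] A := by
    filter_upwards [h] with z hz
    exact propext ⟨fun h => h.1, fun h => ⟨h, hz h⟩⟩
  rw [← d.congr _ _ (hA.inter hB) hA h1, d.inter _ _ hA hB]
  exact inter_subset_right

/-- The trivial density on the σ-algebra of null and conull sets. -/
def trivial (T : Measure Z) [IsProbabilityMeasure T] : PartialDensity T where
  space :=
    { MeasurableSet' := fun A => MeasurableSet[𝔷] A ∧ (T A = 0 ∨ T Aᶜ = 0)
      measurableSet_empty := ⟨MeasurableSet.empty, by simp⟩
      measurableSet_compl := fun A hA => ⟨hA.1.compl, by rw [compl_compl]; exact hA.2.symm⟩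
      measurableSet_iUnion := fun f hf => ⟨MeasurableSet.iUnion fun n => (hf n).1, by
        by_cases h : ∀ n, T (f n) = 0
        · exact Or.inl (measure_iUnion_null h)
        · push Not at h
          obtain ⟨n, hn⟩ := h
          refine Or.inr (measure_mono_null ?_ ((hf n).2.resolve_left hn))
          exact compl_subset_compl.2 (subset_iUnion f n)⟩ }
  le := fun A hA => hA.1
  null := fun A hA h0 => ⟨hA, Or.inl h0⟩
  toFun A := {_z | T A ≠ 0}
  measurable A _ := MeasurableSet.const _
  empty := by simp
  univ := by simp
  inter := by
    rintro A B ⟨hA, hA'⟩ ⟨hB, hB'⟩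
    ext z
    simp only [ne_eq, mem_ofPred_eq, mem_inter_iff]
    constructor
    · exact fun h => ⟨fun h' => h (measure_mono_null inter_subset_left h'),
        fun h' => h (measure_mono_null inter_subset_right h')⟩
    · rintro ⟨h1, h2⟩ h
      have h3 : T (A ∩ B)ᶜ = 0 := by
        rw [compl_inter]
        exact measure_union_null (hA'.resolve_left h1) (hB'.resolve_left h2)
      have h4 : T (A ∩ B ∪ (A ∩ B)ᶜ) = 0 := measure_union_null h h3
      simp at h4
  equiv := by
    rintro A ⟨hA, hA'⟩
    by_cases h : T A = 0
    · have : {_z : Z | T A ≠ 0} = ∅ := by simp [h]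
      rw [this]
      exact (ae_eq_empty.2 h).symm
    · have : {_z : Z | T A ≠ 0} = Set.univ := by simp [h]
      rw [this]
      exact (ae_eq_univ.2 (hA'.resolve_left h)).symm
  congr := by
    rintro A B - - h
    rw [measure_congr h]

/-! ### Limits of increasing sequences of partial densities, by martingale convergence. -/

section Limit

/-- The set where the conditional expectation of `χ_B` is near to `1`. -/
def nearOne (T : Measure Z) (𝔇 : MeasurableSpace Z) (k : ℕ) (B : Set Z) : Set Z :=
  {z | 1 - (2 : ℝ)⁻¹ ^ k < condExp 𝔇 T (B.indicator fun _ => (1 : ℝ)) z}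

theorem measurableSet_nearOne (T : Measure Z) (𝔇 : MeasurableSpace Z) (k : ℕ) (B : Set Z) :
    MeasurableSet[𝔇] (nearOne T 𝔇 k B) :=
  (stronglyMeasurable_condExp (m := 𝔇)).measurable measurableSet_Ioi

theorem nearOne_congr {𝔇 : MeasurableSpace Z} {k : ℕ} {A B : Set Z} (h : A =ᵐ[T] B) :
    nearOne T 𝔇 k A =ᵐ[T] nearOne T 𝔇 k B := by
  have h1 : (A.indicator fun _ => (1 : ℝ)) =ᵐ[T] B.indicator fun _ => (1 : ℝ) :=
    @indicator_ae_eq_of_ae_eq_set _ _ 𝔷 T _ _ _ _ h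
  filter_upwards [condExp_congr_ae (m := 𝔇) h1] with z hz
  change (z ∈ nearOne T 𝔇 k A) = (z ∈ nearOne T 𝔇 k B)
  simp only [nearOne, mem_ofPred_eq, hz]

variable [IsProbabilityMeasure T]

theorem integrable_indicator_one {B : Set Z} (hB : MeasurableSet[𝔷] B) :
    Integrable (B.indicator fun _ => (1 : ℝ)) T :=
  (integrable_const (1 : ℝ)).indicator hB

theorem nearOne_mono {𝔇 : MeasurableSpace Z} {k : ℕ} {A B : Set Z} (hA : MeasurableSet[𝔷] A)
    (hB : MeasurableSet[𝔷] B) (h : A ⊆ B) : nearOne T 𝔇 k A ≤ᵐ[T] nearOne T 𝔇 k B := by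
  have h1 : (A.indicator fun _ => (1 : ℝ)) ≤ᵐ[T] B.indicator fun _ => (1 : ℝ) :=
    Filter.Eventually.of_forall fun z => indicator_le_indicator_of_subset h (fun _ => zero_le_one) z
  filter_upwards [condExp_mono (m := 𝔇) (integrable_indicator_one hA)
    (integrable_indicator_one hB) h1] with z hz hz'
  exact lt_of_lt_of_le hz' hz

/-- Condition the inequality `χ_A + χ_B - 1 ≤ χ_(A ∩ B)`. Two errors below `2⁻¹ ^ (k + 1)` add up to
one below `2⁻¹ ^ k`, which is why the level drops by one. -/
theorem nearOne_inter {𝔇 : MeasurableSpace Z} (h𝔇 : 𝔇 ≤ 𝔷) {k : ℕ} {A B : Set Z}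
    (hA : MeasurableSet[𝔷] A) (hB : MeasurableSet[𝔷] B) :
    (nearOne T 𝔇 (k + 1) A ∩ nearOne T 𝔇 (k + 1) B : Set Z) ≤ᵐ[T] nearOne T 𝔇 k (A ∩ B) := by
  have hiA := integrable_indicator_one (T := T) hA
  have hiB := integrable_indicator_one (T := T) hB
  have h1 : ((A.indicator fun _ => (1 : ℝ)) + B.indicator fun _ => (1 : ℝ)) - (fun _ => (1 : ℝ))
      ≤ᵐ[T] (A ∩ B).indicator fun _ => (1 : ℝ) := by
    refine Filter.Eventually.of_forall fun z => ?_
    by_cases hzA : z ∈ A <;> by_cases hzB : z ∈ B <;> simp [hzA, hzB]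
  filter_upwards [condExp_mono (m := 𝔇) ((hiA.add hiB).sub (integrable_const 1))
      (integrable_indicator_one (hA.inter hB)) h1,
    condExp_sub (m := 𝔇) (hiA.add hiB) (integrable_const (1 : ℝ)),
    condExp_add (m := 𝔇) hiA hiB] with z hz h2 h3 hz'
  rw [h2, Pi.sub_apply, h3, Pi.add_apply, condExp_const h𝔇] at hz
  have hA' : 1 - (2 : ℝ)⁻¹ ^ (k + 1) < _ := hz'.1
  have hB' : 1 - (2 : ℝ)⁻¹ ^ (k + 1) < _ := hz'.2
  change 1 - (2 : ℝ)⁻¹ ^ k < _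
  rw [pow_succ] at hA' hB'
  linarith

theorem nearOne_self {𝔇 : MeasurableSpace Z} (h𝔇 : 𝔇 ≤ 𝔷) {k : ℕ} {A : Set Z}
    (hA : MeasurableSet[𝔇] A) : nearOne T 𝔇 k A = A := by
  have h1 : StronglyMeasurable[𝔇] (A.indicator fun _ => (1 : ℝ)) :=
    stronglyMeasurable_const.indicator hA
  have hk : (0 : ℝ) < 2⁻¹ ^ k := by positivity
  have hk' : (2 : ℝ)⁻¹ ^ k ≤ 1 := pow_le_one₀ (by norm_num) (by norm_num)
  ext z
  rw [nearOne, mem_ofPred_eq,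
    condExp_of_stronglyMeasurable h𝔇 h1 (integrable_indicator_one (h𝔇 _ hA))]
  by_cases hz : z ∈ A <;> simp [hz, hk, -inv_pow, hk']

/-- The filtration of the domains of an increasing sequence. -/
def filtration (a : ℕ → PartialDensity T) (ha : Monotone a) : Filtration ℕ 𝔷 where
  seq n := (a n).space
  mono' _ _ h := (ha h).1
  le' n := (a n).le

/-- The limit of an increasing sequence, obtained from martingale convergence. -/
def limit (a : ℕ → PartialDensity T) (ha : Monotone a) : PartialDensity T where
  space := ⨆ n, (a n).space
  le := iSup_le fun n => (a n).le
  null A hA h0 := le_iSup (fun n => (a n).space) 0 A ((a 0).null A hA h0)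
  toFun B := ⋂ k : ℕ, ⋃ n : ℕ, ⋂ m : ℕ, (a (n + m)).toFun (nearOne T (a (n + m)).space k B)
  measurable B _ := MeasurableSet.iInter fun k => MeasurableSet.iUnion fun n =>
    MeasurableSet.iInter fun m => (a _).measurable _ (measurableSet_nearOne _ _ _ _)
  empty := by
    refine eq_empty_of_forall_notMem fun z hz => ?_
    obtain ⟨n, hn⟩ := mem_iUnion.1 (mem_iInter.1 hz 0)
    have := mem_iInter.1 hn 0
    rw [nearOne_self (a _).le (@MeasurableSet.empty _ (a _).space), (a _).empty] at this
    exact this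
  univ := by
    refine eq_univ_of_forall fun z => ?_
    refine mem_iInter.2 fun k => mem_iUnion.2 ⟨0, mem_iInter.2 fun m => ?_⟩
    rw [nearOne_self (a _).le (@MeasurableSet.univ _ (a _).space), (a _).univ]
    exact mem_univ z
  inter A B hA hB := by
    have hA' := (iSup_le fun n => (a n).le : (⨆ n, (a n).space) ≤ 𝔷) A hA
    have hB' := (iSup_le fun n => (a n).le : (⨆ n, (a n).space) ≤ 𝔷) B hB
    have hm := fun n k C => measurableSet_nearOne T (a n).space k C
    ext z
    simp only [mem_inter_iff, mem_iInter, mem_iUnion]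
    constructor
    · intro h
      refine ⟨fun k => ?_, fun k => ?_⟩
      · obtain ⟨n, hn⟩ := h k
        exact ⟨n, fun m => (a _).mono (hm _ _ _) (hm _ _ _)
          (nearOne_mono (hA'.inter hB') hA' inter_subset_left) (hn m)⟩
      · obtain ⟨n, hn⟩ := h k
        exact ⟨n, fun m => (a _).mono (hm _ _ _) (hm _ _ _)
          (nearOne_mono (hA'.inter hB') hB' inter_subset_right) (hn m)⟩
    · rintro ⟨h1, h2⟩ k
      obtain ⟨n₁, hn₁⟩ := h1 (k + 1)
      obtain ⟨n₂, hn₂⟩ := h2 (k + 1)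
      -- Both conditions hold from index `n₁ + n₂` on; the shifts below rewrite them at the common
      -- index `n₁ + n₂ + m`.
      refine ⟨n₁ + n₂, fun m => ?_⟩
      have e1 := hn₁ (n₂ + m)
      have e2 := hn₂ (n₁ + m)
      rw [← add_assoc] at e1 e2
      rw [add_comm n₂ n₁] at e2
      refine (a _).mono (MeasurableSet.inter (hm _ _ _) (hm _ _ _)) (hm _ _ _)
        (nearOne_inter (a _).le hA' hB') ?_
      rw [(a _).inter _ _ (hm _ _ _) (hm _ _ _)]
      exact ⟨e1, e2⟩
  equiv B hB := by
    have hB' := (iSup_le fun n => (a n).le : (⨆ n, (a n).space) ≤ 𝔷) B hB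
    have h1 : StronglyMeasurable[⨆ n, filtration a ha n] (B.indicator fun _ => (1 : ℝ)) :=
      stronglyMeasurable_const.indicator hB
    have h2 : ∀ᵐ z ∂T, ∀ n k : ℕ, z ∈ (a n).toFun (nearOne T (a n).space k B) ↔
        z ∈ nearOne T (a n).space k B :=
      ae_all_iff.2 fun n => ae_all_iff.2 fun k => by
        filter_upwards [(a n).equiv _ (measurableSet_nearOne T (a n).space k B)] with z hz
        exact iff_of_eq hz
    -- Lévy's upward theorem: the conditional expectations of `χ_B` converge almost everywhere to
    -- `χ_B` itself, as `B` lies in the limit σ-algebra.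
    filter_upwards [h2, (integrable_indicator_one hB').tendsto_ae_condExp h1] with z hz hlim
    refine propext ?_
    change z ∈ (⋂ k : ℕ, ⋃ n : ℕ, ⋂ m : ℕ,
      (a (n + m)).toFun (nearOne T (a (n + m)).space k B)) ↔ z ∈ B
    simp only [mem_iInter, mem_iUnion, hz]
    constructor
    · intro h
      by_contra hzB
      rw [indicator_of_notMem hzB] at hlim
      -- Level `1` means a value above `1/2`, incompatible with convergence to `0`.
      obtain ⟨n, hn⟩ := h 1
      obtain ⟨N, hN⟩ := Filter.eventually_atTop.1 (hlim.eventually_lt_const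
        (show (0 : ℝ) < 2⁻¹ by norm_num))
      have e1 : 1 - (2 : ℝ)⁻¹ ^ 1 < condExp (a (n + N)).space T _ z := hn N
      have e2 : condExp (a (n + N)).space T (B.indicator fun _ => (1 : ℝ)) z < 2⁻¹ :=
        hN (n + N) (by omega)
      norm_num at e1 e2
      linarith
    · intro hzB k
      rw [indicator_of_mem hzB] at hlim
      obtain ⟨N, hN⟩ := Filter.eventually_atTop.1 (hlim.eventually_const_lt
        (show 1 - (2 : ℝ)⁻¹ ^ k < 1 by have : (0 : ℝ) < 2⁻¹ ^ k := by positivity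
                                       linarith))
      exact ⟨N, fun m => hN (N + m) (by omega)⟩
  congr A B _ _ h := by
    refine iInter_congr fun k => iUnion_congr fun n => iInter_congr fun m => ?_
    exact (a _).congr _ _ (measurableSet_nearOne _ _ _ _) (measurableSet_nearOne _ _ _ _)
      (nearOne_congr h)

/-- Once `A` belongs to the `n`-th domain, later conditional expectations leave `χ_A` fixed, so the
sequence defining the limit is constant from index `n` on. -/
theorem le_limit (a : ℕ → PartialDensity T) (ha : Monotone a) (n : ℕ) : a n ≤ limit a ha := by
  refine ⟨le_iSup (fun n => (a n).space) n, fun A hA => ?_⟩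
  have key : ∀ m k, n ≤ m → (a m).toFun (nearOne T (a m).space k A) = (a n).toFun A := by
    intro m k hm
    rw [nearOne_self (a m).le ((ha hm).1 A hA), (ha hm).2 A hA]
  ext z
  simp only [limit, mem_iInter, mem_iUnion]
  constructor
  · intro h
    obtain ⟨i, hi⟩ := h 0
    have := hi n
    rwa [key _ _ (by omega)] at this
  · intro h k
    exact ⟨n, fun m => by rwa [key _ _ (by omega)]⟩

end Limit

/-! ### Unions of chains in which every sequence is bounded. -/

section Union

/-- The union of a chain without countable cofinal subsets. -/
def sUnion (c : Set (PartialDensity T)) (hc : IsChain (· ≤ ·) c) (hne : c.Nonempty)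
    (hub : ∀ a : ℕ → PartialDensity T, (∀ n, a n ∈ c) → ∃ d ∈ c, ∀ n, a n ≤ d) :
    PartialDensity T where
  space :=
    { MeasurableSet' := fun A => ∃ d ∈ c, MeasurableSet[d.space] A
      measurableSet_empty := hne.imp fun d hd => ⟨hd, @MeasurableSet.empty _ d.space⟩
      measurableSet_compl := fun A ⟨d, hd, hA⟩ => ⟨d, hd, MeasurableSet.compl hA⟩
      measurableSet_iUnion := fun f hf => by
        choose a hac hfa using hf
        obtain ⟨d, hd, hle⟩ := hub a hac
        exact ⟨d, hd, MeasurableSet.iUnion fun n => (hle n).1 _ (hfa n)⟩ }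
  le := fun A ⟨d, _, hA⟩ => d.le A hA
  null A hA h0 := hne.imp fun d hd => ⟨hd, d.null A hA h0⟩
  toFun A := {z | ∃ d ∈ c, MeasurableSet[d.space] A ∧ z ∈ d.toFun A}
  measurable := by
    rintro A ⟨d, hd, hA⟩
    rw [chain_toFun hc hd hA]
    exact d.measurable A hA
  empty := by
    obtain ⟨d, hd⟩ := hne
    rw [chain_toFun hc hd (@MeasurableSet.empty _ d.space), d.empty]
  univ := by
    obtain ⟨d, hd⟩ := hne
    rw [chain_toFun hc hd (@MeasurableSet.univ _ d.space), d.univ]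
  inter := by
    rintro A B hA hB
    obtain ⟨d, hd, hA, hB⟩ := chain_common hc hA hB
    rw [chain_toFun hc hd hA, chain_toFun hc hd hB, chain_toFun hc hd (hA.inter hB),
      d.inter _ _ hA hB]
  equiv := by
    rintro A ⟨d, hd, hA⟩
    rw [chain_toFun hc hd hA]
    exact d.equiv A hA
  congr := by
    rintro A B hA hB h
    obtain ⟨d, hd, hA, hB⟩ := chain_common hc hA hB
    rw [chain_toFun hc hd hA, chain_toFun hc hd hB, d.congr _ _ hA hB h]
where
  chain_toFun {c : Set (PartialDensity T)} (hc : IsChain (· ≤ ·) c) {d : PartialDensity T}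
      (hd : d ∈ c) {A : Set Z} (hA : MeasurableSet[d.space] A) :
      {z | ∃ d ∈ c, MeasurableSet[d.space] A ∧ z ∈ d.toFun A} = d.toFun A := by
    ext z
    constructor
    · rintro ⟨e, he, hAe, hz⟩
      rcases hc.total hd he with h | h
      · rwa [h.2 A hA] at hz
      · rwa [h.2 A hAe]
    · exact fun hz => ⟨d, hd, hA, hz⟩
  chain_common {c : Set (PartialDensity T)} (hc : IsChain (· ≤ ·) c) {A B : Set Z}
      (hA : ∃ d ∈ c, MeasurableSet[d.space] A) (hB : ∃ d ∈ c, MeasurableSet[d.space] B) :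
      ∃ d ∈ c, MeasurableSet[d.space] A ∧ MeasurableSet[d.space] B := by
    obtain ⟨d, hd, hA⟩ := hA
    obtain ⟨e, he, hB⟩ := hB
    rcases hc.total hd he with h | h
    · exact ⟨e, he, h.1 A hA, hB⟩
    · exact ⟨d, hd, hA, h.1 B hB⟩

theorem le_sUnion {c : Set (PartialDensity T)} (hc : IsChain (· ≤ ·) c) (hne : c.Nonempty)
    (hub : ∀ a : ℕ → PartialDensity T, (∀ n, a n ∈ c) → ∃ d ∈ c, ∀ n, a n ≤ d)
    {d : PartialDensity T} (hd : d ∈ c) : d ≤ sUnion c hc hne hub :=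
  ⟨fun _ hA => ⟨d, hd, hA⟩, fun _ hA => sUnion.chain_toFun hc hd hA⟩

end Union

/-- If some sequence is cofinal in the chain, the martingale limit is an upper bound. Otherwise
totality puts a member of the chain above any given sequence, so the union of the domains is already
closed under countable unions. -/
theorem bddAbove_of_isChain [IsProbabilityMeasure T] {c : Set (PartialDensity T)}
    (hc : IsChain (· ≤ ·) c) (hne : c.Nonempty) : BddAbove c := by
  by_cases h : ∃ a : ℕ → PartialDensity T, (∀ n, a n ∈ c) ∧ ∀ d ∈ c, ∃ n, d ≤ a n
  · obtain ⟨a, hac, ha⟩ := h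
    have hdir : Directed (· ≤ ·) a := fun i j => by
      rcases hc.total (hac i) (hac j) with h | h
      · exact ⟨j, h, le_rfl⟩
      · exact ⟨i, le_rfl, h⟩
    refine ⟨limit _ hdir.sequence_mono, fun d hd => ?_⟩
    obtain ⟨n, hn⟩ := ha d hd
    exact hn.trans ((hdir.rel_sequence n).trans (le_limit _ hdir.sequence_mono _))
  · push Not at h
    have hub : ∀ a : ℕ → PartialDensity T, (∀ n, a n ∈ c) → ∃ d ∈ c, ∀ n, a n ≤ d := by
      intro a ha
      obtain ⟨d, hd, hn⟩ := h a ha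
      exact ⟨d, hd, fun n => (hc.total hd (ha n)).resolve_left (hn n)⟩
    exact ⟨sUnion c hc hne hub, fun d hd => le_sUnion hc hne hub hd⟩

/-! ### Adjoining one set to the domain of a partial density. -/

section Adjoin

theorem exists_envelope [IsFiniteMeasure T] (d : PartialDensity T) {M : Set Z}
    (hM : MeasurableSet[𝔷] M) : ∃ F, MeasurableSet[d.space] F ∧ M ⊆ F ∧
      ∀ D, MeasurableSet[d.space] D → T (D ∩ M) = 0 → T (D ∩ F) = 0 := by
  refine ⟨@toMeasurable _ d.space (T.trim d.le) M, @measurableSet_toMeasurable _ d.space _ _,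
    @subset_toMeasurable _ d.space _ _, fun D hD h0 => ?_⟩
  -- Null sets belong to the domain, so the trimmed measure also sees `D ∩ M` as null, although `M`
  -- need not be in the domain.
  have hDM : MeasurableSet[d.space] (D ∩ M) := d.null _ ((d.le _ hD).inter hM) h0
  rw [inter_comm, ← trim_measurableSet_eq d.le
      (MeasurableSet.inter (@measurableSet_toMeasurable _ d.space _ _) hD),
    Measure.measure_toMeasurable_inter hD (measure_ne_top _ _), inter_comm,
    trim_measurableSet_eq d.le hDM, h0]

/-- Agreement of `G` and `G'` almost everywhere on `M` spreads to the envelope `F`, because `G ∆ G'`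
lies in the domain. Off `F` one is off `M`, where `H` and `H'` agree. This makes the extended
density independent of the chosen representation. -/
theorem ite_congr_envelope (d : PartialDensity T) {M F G H G' H' : Set Z}
    (hMF : M ⊆ F) (hF : ∀ D, MeasurableSet[d.space] D → T (D ∩ M) = 0 → T (D ∩ F) = 0)
    (hG : MeasurableSet[d.space] G) (hG' : MeasurableSet[d.space] G')
    (h : M.ite G H =ᵐ[T] M.ite G' H') : F.ite G H =ᵐ[T] F.ite G' H' := by
  have h0 := measure_symmDiff_eq_zero_iff.2 h
  have h1 : T ((G ∆ G') ∩ F) = 0 := by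
    refine hF _ (MeasurableSet.symmDiff hG hG') (measure_mono_null ?_ h0)
    intro z hz
    simp only [Set.ite, mem_symmDiff, mem_inter_iff, mem_union, mem_sdiff] at hz ⊢
    tauto
  refine measure_symmDiff_eq_zero_iff.1 (measure_mono_null ?_ (measure_union_null h0 h1))
  intro z hz
  have := @hMF z
  simp only [Set.ite, mem_symmDiff, mem_inter_iff, mem_union, mem_sdiff] at hz ⊢
  tauto

variable (d : PartialDensity T) {M F₁ F₂ : Set Z}

/-- The value of the extended density at `(G ∩ M) ∪ (H \ M)`. -/
def adjoinCore (d : PartialDensity T) (M F₁ F₂ G H : Set Z) : Set Z :=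
  M.ite (d.toFun (F₁.ite G H)) (d.toFun (F₂.ite H G))

theorem adjoinCore_congr (hF₁ : MeasurableSet[d.space] F₁) (hMF₁ : M ⊆ F₁)
    (h₁ : ∀ D, MeasurableSet[d.space] D → T (D ∩ M) = 0 → T (D ∩ F₁) = 0)
    (hF₂ : MeasurableSet[d.space] F₂) (hMF₂ : Mᶜ ⊆ F₂)
    (h₂ : ∀ D, MeasurableSet[d.space] D → T (D ∩ Mᶜ) = 0 → T (D ∩ F₂) = 0) {G H G' H' : Set Z}
    (hG : MeasurableSet[d.space] G) (hH : MeasurableSet[d.space] H)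
    (hG' : MeasurableSet[d.space] G') (hH' : MeasurableSet[d.space] H')
    (h : M.ite G H =ᵐ[T] M.ite G' H') :
    d.adjoinCore M F₁ F₂ G H = d.adjoinCore M F₁ F₂ G' H' := by
  have h' : Mᶜ.ite H G =ᵐ[T] Mᶜ.ite H' G' := by rwa [ite_compl, ite_compl]
  rw [adjoinCore, adjoinCore,
    d.congr _ _ (MeasurableSet.ite hF₁ hG hH) (MeasurableSet.ite hF₁ hG' hH')
      (d.ite_congr_envelope hMF₁ h₁ hG hG' h),
    d.congr _ _ (MeasurableSet.ite hF₂ hH hG) (MeasurableSet.ite hF₂ hH' hG')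
      (d.ite_congr_envelope hMF₂ h₂ hH hH' h')]

/-- The enlarged domain consists of the sets `M.ite G H`. On `M` the density is evaluated at `F₁.ite
G H` and off `M` at `F₂.ite H G`; both depend only on the class of `M.ite G H`, and `ite` commutes
with intersections. -/
theorem exists_adjoin [IsFiniteMeasure T] (hM : MeasurableSet[𝔷] M) :
    ∃ e : PartialDensity T, d ≤ e ∧ MeasurableSet[e.space] M := by
  obtain ⟨F₁, hF₁, hMF₁, h₁⟩ := d.exists_envelope hM
  obtain ⟨F₂, hF₂, hMF₂, h₂⟩ := d.exists_envelope hM.compl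
  have key : ∀ G H, MeasurableSet[d.space] G → MeasurableSet[d.space] H →
      {z | ∃ G' H', MeasurableSet[d.space] G' ∧ MeasurableSet[d.space] H' ∧
        M.ite G H = M.ite G' H' ∧ z ∈ d.adjoinCore M F₁ F₂ G' H'} =
      d.adjoinCore M F₁ F₂ G H := by
    intro G H hG hH
    ext z
    constructor
    · rintro ⟨G', H', hG', hH', h, hz⟩
      rwa [d.adjoinCore_congr hF₁ hMF₁ h₁ hF₂ hMF₂ h₂ hG hH hG' hH' (h ▸ Filter.EventuallyEq.rfl)]
    · exact fun hz => ⟨G, H, hG, hH, rfl, hz⟩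
  have hself : ∀ A, d.adjoinCore M F₁ F₂ A A = d.toFun A := by
    intro A
    simp [adjoinCore]
  let e : PartialDensity T :=
    { space :=
        { MeasurableSet' := fun A => ∃ G H, MeasurableSet[d.space] G ∧ MeasurableSet[d.space] H ∧
            A = M.ite G H
          measurableSet_empty := ⟨∅, ∅, @MeasurableSet.empty _ d.space, @MeasurableSet.empty _ d.space, by simp⟩
          measurableSet_compl := by
            rintro _ ⟨G, H, hG, hH, rfl⟩
            refine ⟨Gᶜ, Hᶜ, MeasurableSet.compl hG, MeasurableSet.compl hH, ?_⟩
            ext z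
            by_cases hz : z ∈ M <;> simp [Set.ite, hz]
          measurableSet_iUnion := by
            intro f hf
            choose G H hG hH hf using hf
            refine ⟨⋃ n, G n, ⋃ n, H n, MeasurableSet.iUnion hG, MeasurableSet.iUnion hH, ?_⟩
            ext z
            by_cases hz : z ∈ M <;> simp [Set.ite, hz, hf] }
      le := by
        rintro _ ⟨G, H, hG, hH, rfl⟩
        exact hM.ite (d.le _ hG) (d.le _ hH)
      null := fun A hA h0 => ⟨A, A, d.null A hA h0, d.null A hA h0, by simp⟩
      toFun := fun A => {z | ∃ G H, MeasurableSet[d.space] G ∧ MeasurableSet[d.space] H ∧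
        A = M.ite G H ∧ z ∈ d.adjoinCore M F₁ F₂ G H}
      measurable := by
        rintro _ ⟨G, H, hG, hH, rfl⟩
        rw [key G H hG hH]
        exact hM.ite (d.measurable _ (MeasurableSet.ite hF₁ hG hH))
          (d.measurable _ (MeasurableSet.ite hF₂ hH hG))
      empty := by
        have := key ∅ ∅ (@MeasurableSet.empty _ d.space) (@MeasurableSet.empty _ d.space)
        rwa [hself, d.empty, ite_same] at this
      univ := by
        have := key Set.univ Set.univ (@MeasurableSet.univ _ d.space) (@MeasurableSet.univ _ d.space)
        rwa [hself, d.univ, ite_same] at this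
      inter := by
        rintro _ _ ⟨G, H, hG, hH, rfl⟩ ⟨G', H', hG', hH', rfl⟩
        rw [← ite_inter_inter, key _ _ hG hH, key _ _ hG' hH',
          key _ _ (MeasurableSet.inter hG hG') (MeasurableSet.inter hH hH')]
        simp only [adjoinCore]
        rw [ite_inter_inter, ite_inter_inter, ← ite_inter_inter M,
          d.inter _ _ (MeasurableSet.ite hF₁ hG hH) (MeasurableSet.ite hF₁ hG' hH'),
          d.inter _ _ (MeasurableSet.ite hF₂ hH hG) (MeasurableSet.ite hF₂ hH' hG')]
      equiv := by
        rintro _ ⟨G, H, hG, hH, rfl⟩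
        rw [key _ _ hG hH]
        filter_upwards [d.equiv _ (MeasurableSet.ite hF₁ hG hH),
          d.equiv _ (MeasurableSet.ite hF₂ hH hG)] with z hz₁ hz₂
        replace hz₁ : z ∈ d.toFun (F₁.ite G H) ↔ z ∈ F₁.ite G H := iff_of_eq hz₁
        replace hz₂ : z ∈ d.toFun (F₂.ite H G) ↔ z ∈ F₂.ite H G := iff_of_eq hz₂
        refine propext ?_
        change z ∈ d.adjoinCore M F₁ F₂ G H ↔ z ∈ M.ite G H
        have i₁ := @hMF₁ z
        have i₂ := @hMF₂ z
        rw [mem_compl_iff] at i₂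
        by_cases hz : z ∈ M
        · have : z ∈ d.toFun (F₁.ite G H) ↔ z ∈ G := hz₁.trans (by simp [Set.ite, i₁ hz])
          simpa [adjoinCore, Set.ite, hz] using this
        · have : z ∈ d.toFun (F₂.ite H G) ↔ z ∈ H := hz₂.trans (by simp [Set.ite, i₂ hz])
          simpa [adjoinCore, Set.ite, hz] using this
      congr := by
        rintro _ _ ⟨G, H, hG, hH, rfl⟩ ⟨G', H', hG', hH', rfl⟩ h
        rw [key _ _ hG hH, key _ _ hG' hH']
        exact d.adjoinCore_congr hF₁ hMF₁ h₁ hF₂ hMF₂ h₂ hG hH hG' hH' h }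
  refine ⟨e, ⟨fun A hA => ⟨A, A, hA, hA, by simp⟩, fun A hA => ?_⟩,
    ⟨Set.univ, ∅, @MeasurableSet.univ _ d.space, @MeasurableSet.empty _ d.space, by simp [Set.ite]⟩⟩
  have := key A A hA hA
  rwa [hself, ite_same] at this

end Adjoin

end PartialDensity

/-- Every probability space has a lower density. -/
theorem exists_isLowerDensity {Z : Type*} {𝔷 : MeasurableSpace Z} (T : Measure Z)
    [IsProbabilityMeasure T] : ∃ δ, IsLowerDensity T δ := by
  have : Nonempty (PartialDensity T) := ⟨PartialDensity.trivial T⟩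
  obtain ⟨d, hd⟩ := zorn_le_nonempty (α := PartialDensity T)
    fun c hc hne => PartialDensity.bddAbove_of_isChain hc hne
  -- A maximal partial density is defined on all measurable sets, since any missing set could be
  -- adjoined.
  have hall : ∀ M, MeasurableSet[𝔷] M → MeasurableSet[d.space] M := by
    intro M hM
    obtain ⟨e, hde, hMe⟩ := d.exists_adjoin hM
    exact (hd hde).1 _ hMe
  exact ⟨d.toFun, fun A hA => d.measurable A (hall A hA), d.empty, d.univ,
    fun A B hA hB => d.inter A B (hall A hA) (hall B hB),
    fun A hA => measure_symmDiff_eq_zero_iff.2 (d.equiv A (hall A hA)),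
    fun A B hA hB h => d.congr A B (hall A hA) (hall B hB) (measure_symmDiff_eq_zero_iff.1 h)⟩

/-! ### Extension of homomorphisms into measure algebras -/

/-- `d` preserves finite meets, the bottom and the top element up to null sets. -/
structure IsMeetHomAE {B X : Type*} [BooleanAlgebra B] {𝔵 : MeasurableSpace X} (μ : Measure X)
    (d : B → Set X) : Prop where
  measurable : ∀ a, MeasurableSet (d a)
  bot : ∀ᵐ x ∂μ, x ∉ d ⊥
  top : ∀ᵐ x ∂μ, x ∈ d ⊤
  inf : ∀ a b, ∀ᵐ x ∂μ, x ∈ d (a ⊓ b) ↔ x ∈ d a ∧ x ∈ d b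

section Extension

variable {B X : Type*} [BooleanAlgebra B] {𝔵 : MeasurableSpace X} {μ : Measure X}

/-- A chain of measurable sets has a countable subset with the same essential supremum. -/
theorem exists_seq_ae_mem_of_chain [IsFiniteMeasure μ] {ι : Type*} {c : Set ι} (hne : c.Nonempty)
    {f : ι → Set X} (hf : ∀ i ∈ c, MeasurableSet (f i))
    (hc : ∀ i ∈ c, ∀ j ∈ c, f i ≤ᵐ[μ] f j ∨ f j ≤ᵐ[μ] f i) :
    ∃ s : ℕ → ι, (∀ n, s n ∈ c) ∧ ∀ i ∈ c, ∀ᵐ x ∂μ, x ∈ f i → ∃ n, x ∈ f (s n) := by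
  -- The sequence is chosen so that its measures approach the supremum over the chain. A member not
  -- below any term contains them all, and its measure cannot exceed that of their union.
  obtain ⟨w, -, hlim, hw⟩ := exists_seq_tendsto_sSup (hne.image fun i => μ (f i))
    (OrderTop.bddAbove _)
  choose s hsc hsw using hw
  refine ⟨s, hsc, fun i hi => ?_⟩
  by_cases h : ∃ n, f i ≤ᵐ[μ] f (s n)
  · obtain ⟨n, hn⟩ := h
    filter_upwards [hn] with x hx hxi
    exact ⟨n, hx hxi⟩
  · push Not at h
    have h1 : ∀ n, f (s n) ≤ᵐ[μ] f i := fun n => (hc i hi _ (hsc n)).resolve_left (h n)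
    have h2 : (⋃ n, f (s n) : Set X) ≤ᵐ[μ] f i := by
      filter_upwards [ae_all_iff.2 h1] with x hx hxs
      obtain ⟨n, hn⟩ := mem_iUnion.1 hxs
      exact hx n hn
    have h3 : μ (f i) ≤ μ (⋃ n, f (s n)) := by
      refine (le_sSup (mem_image_of_mem (fun i => μ (f i)) hi)).trans
        (le_of_tendsto' hlim fun n => ?_)
      rw [← hsw n]
      exact measure_mono (subset_iUnion (fun n => f (s n)) n)
    have h4 := ae_eq_of_ae_subset_of_measure_ge h2 h3
      (MeasurableSet.iUnion fun n => hf _ (hsc n)).nullMeasurableSet (measure_ne_top _ _)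
    filter_upwards [h4] with x hx hxi
    exact mem_iUnion.1 ((iff_of_eq hx).2 hxi)

theorem IsMeetHomAE.mono {d : B → Set X} (hd : IsMeetHomAE μ d) {a b : B} (h : a ≤ b) :
    ∀ᵐ x ∂μ, x ∈ d a → x ∈ d b := by
  filter_upwards [hd.inf a b] with x hx hxa
  rw [inf_eq_left.2 h] at hx
  exact (hx.1 hxa).2

/-- One step of the extension: a larger map which decides `e`. -/
theorem IsMeetHomAE.exists_decide {d : B → Set X} (hd : IsMeetHomAE μ d) (e : B) :
    ∃ d' : B → Set X, IsMeetHomAE μ d' ∧ (∀ a, d a ⊆ d' a) ∧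
      ∀ᵐ x ∂μ, x ∈ d' e ∨ x ∈ d eᶜ := by
  have hD : MeasurableSet (d e ∪ d eᶜ)ᶜ := ((hd.measurable e).union (hd.measurable eᶜ)).compl
  -- On the undecided region `a` is replaced by `a ⊔ eᶜ`. Distributivity keeps meets; the value at
  -- `⊥` stays null because `d eᶜ` misses that region, and `e ⊔ eᶜ = ⊤` makes the new value at `e`
  -- cover it.
  refine ⟨fun a => d a ∪ ((d e ∪ d eᶜ)ᶜ ∩ d (a ⊔ eᶜ)),
    ⟨fun a => (hd.measurable a).union (hD.inter (hd.measurable _)), ?_, ?_, fun a b => ?_⟩,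
    fun a => subset_union_left, ?_⟩
  · filter_upwards [hd.bot] with x hx
    simp [hx]
  · filter_upwards [hd.top] with x hx
    exact Or.inl hx
  · filter_upwards [hd.inf a b, hd.inf (a ⊔ eᶜ) (b ⊔ eᶜ), hd.mono (a := a) (b := a ⊔ eᶜ) le_sup_left,
      hd.mono (a := b) (b := b ⊔ eᶜ) le_sup_left] with x h1 h2 h3 h4
    rw [← sup_inf_right] at h2
    simp only [mem_union, mem_inter_iff, h1, h2]
    tauto
  · filter_upwards [hd.top] with x hx
    simp only [mem_union, mem_inter_iff, mem_compl_iff, sup_compl_eq_top, hx]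
    tauto

/-- A meet homomorphism into a measure algebra can be enlarged to a Boolean homomorphism. -/
theorem IsMeetHomAE.exists_extension [IsFiniteMeasure μ] {d : B → Set X}
    (hd : IsMeetHomAE μ d) :
    ∃ h : B → Set X, IsMeetHomAE μ h ∧ (∀ a, ∀ᵐ x ∂μ, x ∈ d a → x ∈ h a) ∧
      ∀ a, ∀ᵐ x ∂μ, x ∈ h a ∨ x ∈ h aᶜ := by
  let r : {h : B → Set X // IsMeetHomAE μ h ∧ ∀ a, ∀ᵐ x ∂μ, x ∈ d a → x ∈ h a} →
      {h : B → Set X // IsMeetHomAE μ h ∧ ∀ a, ∀ᵐ x ∂μ, x ∈ d a → x ∈ h a} → Prop :=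
    fun p q => ∀ a, ∀ᵐ x ∂μ, x ∈ p.1 a → x ∈ q.1 a
  have hr : ∀ p, r p p := fun p a => Filter.Eventually.of_forall fun x => id
  obtain ⟨⟨m, hm, hdm⟩, hmax⟩ := exists_maximal_of_chains_bounded (r := r) (by
    intro c hc
    rcases c.eq_empty_or_nonempty with rfl | hne
    · exact ⟨⟨d, hd, fun a => Filter.Eventually.of_forall fun x => id⟩, by simp⟩
    have htot : ∀ p ∈ c, ∀ q ∈ c, r p q ∨ r q p := by
      intro p hp q hq
      by_cases h : p = q
      · exact Or.inl (h ▸ hr p)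
      · exact hc hp hq h
    -- The chain may be uncountable, so its supremum is taken in the measure algebra: for each `a`
    -- separately a countable subfamily attains the essential supremum.
    have hseq := fun a => exists_seq_ae_mem_of_chain (μ := μ) hne (f := fun p => p.1 a)
      (fun p _ => p.2.1.measurable a)
      (fun p hp q hq => (htot p hp q hq).imp (fun h => h a) (fun h => h a))
    choose s hsc hs using hseq
    have hub : ∀ p ∈ c, ∀ a, ∀ᵐ x ∂μ, x ∈ p.1 a → x ∈ ⋃ n, (s a n).1 a := by
      intro p hp a
      filter_upwards [hs a p hp] with x hx hxp
      exact mem_iUnion.2 (hx hxp)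
    have hmono : ∀ a b, a ≤ b → ∀ᵐ x ∂μ, x ∈ ⋃ n, (s a n).1 a → x ∈ ⋃ n, (s b n).1 b := by
      intro a b hab
      filter_upwards [ae_all_iff.2 fun n => (s a n).2.1.mono hab,
        ae_all_iff.2 fun n => hub _ (hsc a n) b] with x h1 h2 hx
      obtain ⟨n, hn⟩ := mem_iUnion.1 hx
      exact h2 n (h1 n hn)
    obtain ⟨p₀, hp₀⟩ := hne
    refine ⟨⟨fun a => ⋃ n, (s a n).1 a,
      ⟨fun a => MeasurableSet.iUnion fun n => (s a n).2.1.measurable a, ?_, ?_, ?_⟩, ?_⟩,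
      fun p hp a => hub p hp a⟩
    · filter_upwards [ae_all_iff.2 fun n => (s ⊥ n).2.1.bot] with x hx
      simpa using hx
    · filter_upwards [hub p₀ hp₀ ⊤, p₀.2.1.top] with x h1 h2
      exact h1 h2
    · intro a b
      have h1 : ∀ i j, ∀ᵐ x ∂μ, x ∈ (s a i).1 a → x ∈ (s b j).1 b →
          x ∈ ⋃ n, (s (a ⊓ b) n).1 (a ⊓ b) := by
        intro i j
        -- The larger of the two chain members contains both points of evidence, and it preserves
        -- the meet.
        rcases htot _ (hsc a i) _ (hsc b j) with h | h
        · filter_upwards [h a, (s b j).2.1.inf a b, hub _ (hsc b j) (a ⊓ b)] with x h1 h2 h3 h4 h5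
          exact h3 (h2.2 ⟨h1 h4, h5⟩)
        · filter_upwards [h b, (s a i).2.1.inf a b, hub _ (hsc a i) (a ⊓ b)] with x h1 h2 h3 h4 h5
          exact h3 (h2.2 ⟨h4, h1 h5⟩)
      filter_upwards [ae_all_iff.2 fun i => ae_all_iff.2 (h1 i), hmono (a ⊓ b) a inf_le_left,
        hmono (a ⊓ b) b inf_le_right] with x h2 h3 h4
      refine ⟨fun hx => ⟨h3 hx, h4 hx⟩, fun ⟨hxa, hxb⟩ => ?_⟩
      obtain ⟨i, hi⟩ := mem_iUnion.1 hxa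
      obtain ⟨j, hj⟩ := mem_iUnion.1 hxb
      exact h2 i j hi hj
    · intro a
      filter_upwards [hub p₀ hp₀ a, p₀.2.2 a] with x h1 h2 hx
      exact h1 (h2 hx))
    (fun {p q t} h h' a => by
      filter_upwards [h a, h' a] with x h1 h2 hx
      exact h2 (h1 hx))
  refine ⟨m, hm, hdm, fun e => ?_⟩
  obtain ⟨d', hd', hle, hdec⟩ := hm.exists_decide e
  -- By maximality the enlargement deciding `e` gains nothing up to null sets, so `m` already
  -- decides `e`.
  have hback := hmax ⟨d', hd', fun a => by
    filter_upwards [hdm a] with x hx hxa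
    exact hle a (hx hxa)⟩ (fun a => Filter.Eventually.of_forall fun x hx => hle a hx) e
  filter_upwards [hback, hdec] with x h1 h2
  exact h2.imp_left h1

end Extension

/-! ### Homomorphisms of measure algebras obtained from a lower density. -/

/-- `h` induces a homomorphism from the measure algebra of `T` to that of `μ`. -/
structure IsMeasureAlgebraHom {Z X : Type*} {𝔷 : MeasurableSpace Z} (T : Measure Z)
    {𝔵 : MeasurableSpace X} (μ : Measure X) (h : Set Z → Set X) : Prop where
  measurable : ∀ W, MeasurableSet W → MeasurableSet (h W)
  empty : ∀ᵐ x ∂μ, x ∉ h ∅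
  inter : ∀ V W, MeasurableSet V → MeasurableSet W →
    ∀ᵐ x ∂μ, x ∈ h (V ∩ W) ↔ x ∈ h V ∧ x ∈ h W
  compl : ∀ W, MeasurableSet W → ∀ᵐ x ∂μ, x ∈ h Wᶜ ↔ x ∉ h W
  congr : ∀ V W, MeasurableSet V → MeasurableSet W → V =ᵐ[T] W → h V =ᵐ[μ] h W

/-- The preimages `g ⁻¹' δ W` preserve meets exactly, so they extend to a Boolean homomorphism
modulo `μ`. No relation between `μ` and the image of `T` is needed: equivalence is respected because
`δ` sends conull sets to the whole space. -/
theorem IsLowerDensity.exists_measureAlgebraHom {Z X : Type*} {𝔷 : MeasurableSpace Z}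
    {T : Measure Z} {δ : Set Z → Set Z} (hδ : IsLowerDensity T δ) {𝔵 : MeasurableSpace X}
    (μ : Measure X) [IsFiniteMeasure μ] {g : X → Z} (hg : Measurable g) :
    ∃ h : Set Z → Set X, IsMeasureAlgebraHom T μ h ∧
      ∀ W, MeasurableSet W → ∀ᵐ x ∂μ, g x ∈ δ W → x ∈ h W := by
  classical
  have hd : IsMeetHomAE μ fun W : {W : Set Z // MeasurableSet W} => g ⁻¹' δ W.1 :=
    { measurable := fun W => hg (hδ.measurable _ W.2)
      bot := Filter.Eventually.of_forall fun x => by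
        change g x ∉ δ ∅
        rw [hδ.empty]; simp
      top := Filter.Eventually.of_forall fun x => by
        change g x ∈ δ Set.univ
        rw [hδ.univ]; simp
      inf := fun V W => Filter.Eventually.of_forall fun x => by
        change g x ∈ δ (V.1 ∩ W.1) ↔ _
        rw [hδ.inter _ _ V.2 W.2]; rfl }
  obtain ⟨h, hh, hle, hdec⟩ := hd.exists_extension
  have hinter : ∀ V W (hV : MeasurableSet V) (hW : MeasurableSet W),
      ∀ᵐ x ∂μ, x ∈ h ⟨V ∩ W, hV.inter hW⟩ ↔ x ∈ h ⟨V, hV⟩ ∧ x ∈ h ⟨W, hW⟩ :=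
    fun V W hV hW => hh.inf ⟨V, hV⟩ ⟨W, hW⟩
  refine ⟨fun W => if hW : MeasurableSet W then h ⟨W, hW⟩ else ∅, ⟨?_, ?_, ?_, ?_, ?_⟩, ?_⟩
  · intro W hW
    rw [dif_pos hW]
    exact hh.measurable _
  · rw [dif_pos MeasurableSet.empty]
    exact hh.bot
  · intro V W hV hW
    rw [dif_pos hV, dif_pos hW, dif_pos (hV.inter hW)]
    exact hinter V W hV hW
  · intro W hW
    rw [dif_pos hW, dif_pos hW.compl]
    filter_upwards [hh.inf ⟨W, hW⟩ ⟨W, hW⟩ᶜ, hdec ⟨W, hW⟩, hh.bot] with x h1 h2 h3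
    rw [inf_compl_eq_bot] at h1
    change x ∈ h ⟨W, hW⟩ᶜ ↔ _
    tauto
  · intro V W hV hW hVW
    rw [dif_pos hV, dif_pos hW]
    have hG : MeasurableSet (V ∆ W)ᶜ := (hV.symmDiff hW).compl
    -- Hence `h` of this set is conull, and `V` and `W` have the same intersection with it.
    have h1 : δ (V ∆ W)ᶜ = Set.univ := by
      rw [← hδ.univ]
      refine hδ.congr _ _ hG MeasurableSet.univ ?_
      rw [← compl_symmDiff_compl, compl_compl, compl_univ]
      simpa using measure_symmDiff_eq_zero_iff.2 hVW
    have h2 : V ∩ (V ∆ W)ᶜ = W ∩ (V ∆ W)ᶜ := by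
      ext z
      simp only [mem_inter_iff, mem_compl_iff, mem_symmDiff]
      tauto
    have h3 := hinter V _ hV hG
    have h4 := hinter W _ hW hG
    simp only [h2] at h3
    filter_upwards [h3, h4, hle ⟨_, hG⟩] with x h3 h4 h5
    have h6 := h5 (by change g x ∈ δ (V ∆ W)ᶜ; rw [h1]; trivial)
    refine propext ?_
    change x ∈ h ⟨V, hV⟩ ↔ x ∈ h ⟨W, hW⟩
    tauto
  · intro W hW
    simp only [dif_pos hW]
    exact hle ⟨W, hW⟩

/-! ### Null sets of the extended measure and sections of product sets. -/

namespace IsDisintegration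

variable {X : Type u} {Y : Type v} {𝔄 : MeasurableSpace X} [𝔅 : MeasurableSpace Y]
  {Q : Measure Y} {R : Measure (X × Y)} {𝔄y : Y → MeasurableSpace X}
  {S : ∀ y, @Measure X (𝔄y y)} (hS : IsDisintegration Q R 𝔄y S)

theorem bigMeasure_apply {V : Set (X × Y)} (hV : MeasurableSet[bigSpace 𝔄 Q 𝔄y S] V) :
    bigMeasure hS V = ∫⁻ y, S y (sec V y) ∂Q :=
  @Measure.ofMeasurable_apply _ (bigSpace 𝔄 Q 𝔄y S) _ _ _ V hV

theorem bigMeasure_eq_zero_iff {V : Set (X × Y)} (hV : MeasurableSet[bigSpace 𝔄 Q 𝔄y S] V) :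
    bigMeasure hS V = 0 ↔ ∀ᵐ y ∂Q, S y (sec V y) = 0 := by
  rw [hS.bigMeasure_apply hV, lintegral_eq_zero_iff' (hS.sec_big hV).2]
  rfl

theorem isProbabilityMeasure_bigMeasure [IsProbabilityMeasure Q] :
    IsProbabilityMeasure (bigMeasure hS) := by
  refine ⟨?_⟩
  rw [hS.bigMeasure_apply (@MeasurableSet.univ _ (bigSpace 𝔄 Q 𝔄y S))]
  have : ∀ y, S y (sec univ y) = 1 := fun y => hS.prob y
  simp [this]

end IsDisintegration

theorem sec_symmDiff_eq_zero_iff {X : Type u} {Y : Type v} {𝔵 : MeasurableSpace X} {μ : Measure X} {E F : Set (X × Y)}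
    {y : Y} : μ (sec (E ∆ F) y) = 0 ↔ ∀ᵐ x ∂μ, (x, y) ∈ E ↔ (x, y) ∈ F := by
  change μ (sec E y ∆ sec F y) = 0 ↔ _
  rw [measure_symmDiff_eq_zero_iff]
  exact Filter.eventually_congr (Filter.Eventually.of_forall fun x => eq_iff_iff)

section Product

variable {X : Type u} {Y : Type v} {𝔄 : MeasurableSpace X} [𝔅 : MeasurableSpace Y]
  {Q : Measure Y} {𝔄y : Y → MeasurableSpace X} {S : ∀ y, @Measure X (𝔄y y)}

theorem mem_leftNil_iff {E : Set (X × Y)} :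
    E ∈ leftNil Q 𝔄y S ↔ ∀ᵐ y ∂Q, S y (sec E y) = 0 := by
  constructor
  · rintro ⟨N, -, hQ, h⟩
    filter_upwards [measure_eq_zero_iff_ae_notMem.1 hQ] with y hy
    exact h y hy
  · intro h
    obtain ⟨N, hsub, hN, hQ⟩ := exists_measurable_superset_of_null (ae_iff.1 h)
    exact ⟨N, hN, hQ, fun y hy => by
      by_contra h'
      exact hy (hsub h')⟩

theorem prod_le_bigSpace : 𝔄.prod 𝔅 ≤ bigSpace 𝔄 Q 𝔄y S := fun W hW =>
  ⟨W, ∅, hW, mem_leftNil_iff.2 (Filter.Eventually.of_forall fun y => measure_empty (μ := S y)),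
    (symmDiff_bot W).symm⟩

theorem measurableSet_sec {𝔆 : MeasurableSpace X} {W : Set (X × Y)}
    (hW : MeasurableSet[𝔆.prod 𝔅] W) (y : Y) : MeasurableSet[𝔆] (sec W y) :=
  @measurable_prodMk_right _ _ 𝔆 𝔅 y _ hW

end Product

/-- Up to null sets, the inner regular σ-algebra contains all the measurable sets. -/
theorem IsInnerRegularWrt.exists_subset_null {X : Type u} {𝔄 : MeasurableSpace X} {P : Measure X}
    {𝔆 : MeasurableSpace X} (h : IsInnerRegularWrt P 𝔆) {A : Set X} (hA : MeasurableSet[𝔄] A) :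
    ∃ C, MeasurableSet[𝔆] C ∧ C ⊆ A ∧ P (A \ C) = 0 := by
  -- For `n = 0` the bound is `∞`, which is harmless.
  choose D hD hDA hP using fun n : ℕ => h A hA (n : ℝ≥0∞)⁻¹
    (ENNReal.inv_pos.2 (ENNReal.natCast_ne_top n))
  refine ⟨⋃ n, D n, MeasurableSet.iUnion hD, iUnion_subset hDA, ?_⟩
  by_contra h0
  obtain ⟨n, hn⟩ := ENNReal.exists_inv_nat_lt h0
  exact absurd (hn.trans_le (measure_mono (sdiff_subset_sdiff_right (subset_iUnion D n))))
    (hP n).le.not_gt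

theorem exists_equiv_of_innerRegular {X : Type u} {Y : Type v} {𝔆 𝔄 : MeasurableSpace X}
    [𝔅 : MeasurableSpace Y] {P : Measure X} {Q : Measure Y} {R : Measure (X × Y)}
    (hR : IsSkewProduct P Q R) {𝔄y : Y → MeasurableSpace X} {S : ∀ y, @Measure X (𝔄y y)}
    (hS : IsDisintegration Q R 𝔄y S) (h𝔆 : 𝔆 ≤ 𝔄)
    (hP𝔆 : IsInnerRegularWrt P 𝔆) {E : Set (X × Y)}
    (hE : MeasurableSet[bigSpace 𝔄 Q 𝔄y S] E) :
    ∃ W, MeasurableSet[𝔆.prod 𝔅] W ∧ ∀ᵐ y ∂Q, S y (sec (E ∆ W) y) = 0 := by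
  have hprod : ∀ V, MeasurableSet[𝔄.prod 𝔅] V →
      ∃ W, MeasurableSet[𝔆.prod 𝔅] W ∧ ∀ᵐ y ∂Q, S y (sec (V ∆ W) y) = 0 := by
    intro V hV
    have hV' : MeasurableSet[MeasurableSpace.generateFrom (image2 (· ×ˢ ·)
        {A : Set X | MeasurableSet A} {B : Set Y | MeasurableSet B})] V := by
      rw [generateFrom_prod]
      exact hV
    clear hV
    induction V, hV' using MeasurableSpace.generateFrom_induction with
    | hC V hV _ =>
      obtain ⟨A, hA, B, hB, rfl⟩ := hV
      obtain ⟨C, hC, hCA, h0⟩ := hP𝔆.exists_subset_null hA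
      have hAC : MeasurableSet (A \ C) := MeasurableSet.diff hA (h𝔆 _ hC)
      have h1 : ∫⁻ y, S y (A \ C) ∂Q = 0 := by
        have := hS.dis2 (A \ C) univ hAC MeasurableSet.univ
        rw [Measure.restrict_univ] at this
        rw [this, prod_univ, ← Measure.fst_apply hAC, hR.1, h0]
      have h2 : AEMeasurable (fun y => S y (A \ C)) Q := by
        simpa only [sec, mem_prod, mem_univ, and_true, ofPred_mem_eq] using
          (hS.sec_prod (hAC.prod MeasurableSet.univ)).2
      refine ⟨C ×ˢ B, @MeasurableSet.prod _ _ 𝔆 𝔅 _ _ hC hB, ?_⟩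
      filter_upwards [(lintegral_eq_zero_iff' h2).1 h1] with y hy
      refine measure_mono_null ?_ hy
      intro x hx
      simp only [sec, mem_symmDiff, mem_prod, mem_ofPred_eq] at hx
      have := @hCA x
      simp only [mem_sdiff]
      tauto
    | empty =>
      exact ⟨∅, @MeasurableSet.empty _ (𝔆.prod 𝔅), Filter.Eventually.of_forall fun y => by
        simp [sec]⟩
    | compl V _ ih =>
      obtain ⟨W, hW, h⟩ := ih
      refine ⟨Wᶜ, MeasurableSet.compl hW, ?_⟩
      rwa [compl_symmDiff_compl]
    | iUnion f _ ih =>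
      choose W hW h using ih
      refine ⟨⋃ n, W n, MeasurableSet.iUnion hW, ?_⟩
      filter_upwards [ae_all_iff.2 h] with y hy
      refine measure_mono_null ?_ (measure_iUnion_null hy)
      intro x hx
      simp only [sec, mem_symmDiff, mem_iUnion, mem_ofPred_eq] at hx ⊢
      rcases hx with ⟨⟨n, hn⟩, h⟩ | ⟨⟨n, hn⟩, h⟩
      · exact ⟨n, Or.inl ⟨hn, fun h' => h ⟨n, h'⟩⟩⟩
      · exact ⟨n, Or.inr ⟨hn, fun h' => h ⟨n, h'⟩⟩⟩
  obtain ⟨V, N, hV, hN, rfl⟩ := hE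
  obtain ⟨W, hW, h⟩ := hprod V hV
  refine ⟨W, hW, ?_⟩
  filter_upwards [h, mem_leftNil_iff.1 hN] with y h1 h2
  refine measure_mono_null ?_ (measure_union_null h1 h2)
  intro x hx
  simp only [sec, mem_symmDiff, mem_union, mem_ofPred_eq] at hx ⊢
  tauto

/-! ### Construction of the density `ψ`. -/

theorem propositionp3 {X : Type u} {Y : Type v} [𝔄 : MeasurableSpace X] [𝔅 : MeasurableSpace Y]
    (P : Measure X) [IsProbabilityMeasure P] (Q : Measure Y) [IsProbabilityMeasure Q]
    (R : Measure (X × Y)) [IsProbabilityMeasure R] (hR : IsSkewProduct P Q R)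
    (𝔄y : Y → MeasurableSpace X) (S : ∀ y, @Measure X (𝔄y y))
    (hS : IsDisintegration Q R 𝔄y S)
    (𝔆 : MeasurableSpace X) (h𝔆 : ∀ y, 𝔆 ≤ 𝔄y y)
    (hP𝔆 : IsInnerRegularWrt P 𝔆) (hS𝔆 : ∀ y, IsInnerRegularWrt (S y) 𝔆)
    (κ : Ordinal.{u}) (M : Ordinal.{u} → Set X) (τ : Y → Set X → Set X)
    (hτ : IsEquiAdmissible 𝔄y S 𝔆 h𝔆 κ M τ) :
    ∃ ψ : Set (X × Y) → Set (X × Y),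
      IsLowerDensity (bigMeasure hS) ψ ∧
      (∀ E, MeasurableSet[bigSpace 𝔄 Q 𝔄y S] E → ψ E ∈ smallSets 𝔆 Q 𝔄y S) ∧
      (∀ E, MeasurableSet[bigSpace 𝔄 Q 𝔄y S] E → ∀ y,
        S y (sec (ψ E) y ∪ sec (ψ Eᶜ) y) = 1) ∧
      (∀ E, MeasurableSet[bigSpace 𝔄 Q 𝔄y S] E → ∀ y,
        sec (ψ E) y = extendDensity (S y) 𝔆 (τ y) (sec (ψ E) y)) := by
  classical
  obtain ⟨y₀⟩ := Q.nonempty_of_neZero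
  have h𝔆𝔄 : 𝔆 ≤ 𝔄 := (h𝔆 y₀).trans (IsDisintegration.le (𝔄 := 𝔄) hS y₀)
  have hle : 𝔆.prod 𝔅 ≤ bigSpace 𝔄 Q 𝔄y S :=
    (sup_le_sup_right (MeasurableSpace.comap_mono h𝔆𝔄) _).trans prod_le_bigSpace
  have := hS.isProbabilityMeasure_bigMeasure
  have hprob : ∀ y, S y univ = 1 := IsDisintegration.prob (𝔄 := 𝔄) hS
  have hfin : ∀ y, IsFiniteMeasure (S y) := fun y => ⟨hprob y ▸ ENNReal.one_lt_top⟩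
  have hT1 : IsProbabilityMeasure ((bigMeasure hS).trim hle) :=
    ⟨by rw [trim_measurableSet_eq hle (@MeasurableSet.univ _ (𝔆.prod 𝔅))]; exact measure_univ⟩
  obtain ⟨δ, hδ⟩ := exists_isLowerDensity ((bigMeasure hS).trim hle)
  have hTeq : ∀ V W, MeasurableSet[𝔆.prod 𝔅] V → MeasurableSet[𝔆.prod 𝔅] W →
      (V =ᵐ[(bigMeasure hS).trim hle] W ↔
        ∀ᵐ y ∂Q, ∀ᵐ x ∂(S y), (x, y) ∈ V ↔ (x, y) ∈ W) := by
    intro V W hV hW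
    have hVW : MeasurableSet[𝔆.prod 𝔅] (V ∆ W) := MeasurableSet.symmDiff hV hW
    rw [← measure_symmDiff_eq_zero_iff, trim_measurableSet_eq hle hVW,
      hS.bigMeasure_eq_zero_iff (hle _ hVW)]
    exact Filter.eventually_congr (Filter.Eventually.of_forall fun y =>
      sec_symmDiff_eq_zero_iff)
  have hext := fun y => hδ.exists_measureAlgebraHom ((S y).trim (h𝔆 y)) (g := fun x => (x, y))
    (fun W hW => measurableSet_sec hW y)
  choose h hh hδh using hext
  have hτd : ∀ y, IsLowerDensity ((S y).trim (h𝔆 y)) (τ y) := fun y => (hτ.2.choose_spec.2 y).1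
  have hrep : ∀ E : Set (X × Y), ∃ W, MeasurableSet[𝔆.prod 𝔅] W ∧
      (MeasurableSet[bigSpace 𝔄 Q 𝔄y S] E →
        ∀ᵐ y ∂Q, ∀ᵐ x ∂(S y), (x, y) ∈ E ↔ (x, y) ∈ W) := by
    intro E
    by_cases hE : MeasurableSet[bigSpace 𝔄 Q 𝔄y S] E
    · obtain ⟨W, hW, h0⟩ := exists_equiv_of_innerRegular hR hS h𝔆𝔄 hP𝔆 hE
      exact ⟨W, hW, fun _ => h0.mono fun y hy => sec_symmDiff_eq_zero_iff.1 hy⟩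
    · exact ⟨∅, @MeasurableSet.empty _ (𝔆.prod 𝔅), fun h => absurd h hE⟩
  choose w hw hwE using hrep
  have hwT : ∀ E V, MeasurableSet[bigSpace 𝔄 Q 𝔄y S] E → MeasurableSet[𝔆.prod 𝔅] V →
      (∀ᵐ y ∂Q, ∀ᵐ x ∂(S y), (x, y) ∈ E ↔ (x, y) ∈ V) →
      ∀ y, h y (w E) =ᵐ[(S y).trim (h𝔆 y)] h y V := by
    intro E V hE hV hEV y
    refine (hh y).congr _ _ (hw E) hV ((hTeq _ _ (hw E) hV).2 ?_)
    filter_upwards [hEV, hwE E hE] with y h1 h2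
    filter_upwards [h1, h2] with x h3 h4
    exact h4.symm.trans h3
  have hhm : ∀ y E, MeasurableSet[𝔆] (h y (w E)) := fun y E => (hh y).measurable _ (hw E)
  have hτc : ∀ y E A, MeasurableSet[𝔆] A → h y (w E) =ᵐ[(S y).trim (h𝔆 y)] A →
      τ y (h y (w E)) = τ y A := fun y E A hA hEA =>
    (hτd y).congr _ _ (hhm y E) hA (measure_symmDiff_eq_zero_iff.2 hEA)
  have hτm : ∀ y E, MeasurableSet[𝔆] (τ y (h y (w E))) :=
    fun y E => (hτd y).measurable _ (hhm y E)
  have hττ : ∀ y E, τ y (h y (w E)) =ᵐ[(S y).trim (h𝔆 y)] h y (w E) := fun y E =>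
    measure_symmDiff_eq_zero_iff.1 ((hτd y).equiv _ (hhm y E))
  have hwc : ∀ E, MeasurableSet[bigSpace 𝔄 Q 𝔄y S] E → ∀ y,
      ∀ᵐ x ∂((S y).trim (h𝔆 y)), x ∈ h y (w Eᶜ) ↔ x ∉ h y (w E) := by
    intro E hE y
    have h1 := hwT Eᶜ (w E)ᶜ (MeasurableSet.compl hE) (MeasurableSet.compl (hw E))
      ((hwE E hE).mono fun y hy => hy.mono fun x hx => not_congr hx) y
    filter_upwards [h1, (hh y).compl _ (hw E)] with x h2 h3
    exact (iff_of_eq h2).trans h3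
  -- For almost every `y`, `h y` contains the sections of `W` and `Wᶜ` (those of `δ W` and `δ Wᶜ`)
  -- in its values at `W` and `Wᶜ`. These values are complementary, so the inclusions are equalities
  -- modulo null sets.
  have hψw : ∀ E, ∀ᵐ y ∂Q, ∀ᵐ x ∂(S y), (x, y) ∈ w E ↔ x ∈ τ y (h y (w E)) := by
    intro E
    have hE := hw E
    have hE' : MeasurableSet[𝔆.prod 𝔅] (w E)ᶜ := MeasurableSet.compl hE
    have h1 := (hTeq _ _ (hδ.measurable _ hE) hE).1
      (measure_symmDiff_eq_zero_iff.1 (hδ.equiv _ hE))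
    have h2 := (hTeq _ _ (hδ.measurable _ hE') hE').1
      (measure_symmDiff_eq_zero_iff.1 (hδ.equiv _ hE'))
    filter_upwards [h1, h2] with y h1 h2
    filter_upwards [h1, h2, ae_of_ae_trim (h𝔆 y) (hττ y E), ae_of_ae_trim (h𝔆 y) (hδh y _ hE),
      ae_of_ae_trim (h𝔆 y) (hδh y _ hE'), ae_of_ae_trim (h𝔆 y) ((hh y).compl _ hE)]
      with x h1 h2 h3 h4 h5 h6
    replace h3 : x ∈ τ y (h y (w E)) ↔ x ∈ h y (w E) := iff_of_eq h3
    rw [mem_compl_iff] at h2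
    tauto
  let ψ : Set (X × Y) → Set (X × Y) := fun E => {p | p.1 ∈ τ p.2 (h p.2 (w E))}
  have hψ : ∀ E, ψ E ∈ smallSets 𝔆 Q 𝔄y S := by
    intro E
    have h0 : ∀ᵐ y ∂Q, S y (sec (w E ∆ ψ E) y) = 0 :=
      (hψw E).mono fun y hy => sec_symmDiff_eq_zero_iff.2 hy
    refine ⟨w E, w E ∆ ψ E, hw E, ⟨fun y => ?_, (mem_leftNil_iff (𝔄y := 𝔄y)).2 h0⟩, by simp⟩
    exact (h𝔆 y _ (MeasurableSet.symmDiff (measurableSet_sec (hw E) y) (hτm y E))).nullMeasurableSet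
  have hψm : ∀ E, MeasurableSet[bigSpace 𝔄 Q 𝔄y S] (ψ E) := by
    intro E
    obtain ⟨W, N, hW, hN, hE⟩ := hψ E
    exact ⟨W, N, sup_le_sup_right (MeasurableSpace.comap_mono h𝔆𝔄) _ _ hW, hN.2, hE⟩
  refine ⟨ψ, ⟨fun E _ => hψm E, ?_, ?_, ?_, ?_, ?_⟩, fun E _ => hψ E, ?_, ?_⟩
  · ext ⟨x, y⟩
    have h1 := hwT ∅ ∅ (@MeasurableSet.empty _ (bigSpace 𝔄 Q 𝔄y S))
      (@MeasurableSet.empty _ (𝔆.prod 𝔅)) (by simp) y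
    have h2 : h y (w ∅) =ᵐ[(S y).trim (h𝔆 y)] (∅ : Set X) :=
      h1.trans ((hh y).empty.mono fun x hx => eq_false hx)
    change x ∈ τ y (h y (w ∅)) ↔ _
    rw [hτc y _ ∅ (@MeasurableSet.empty _ 𝔆) h2, (hτd y).empty]
    rfl
  · ext ⟨x, y⟩
    have h1 := hwT univ ∅ᶜ (@MeasurableSet.univ _ (bigSpace 𝔄 Q 𝔄y S))
      (MeasurableSet.compl (@MeasurableSet.empty _ (𝔆.prod 𝔅))) (by simp) y
    have h2 : h y (w univ) =ᵐ[(S y).trim (h𝔆 y)] (univ : Set X) := by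
      filter_upwards [h1, (hh y).compl _ (@MeasurableSet.empty _ (𝔆.prod 𝔅)), (hh y).empty]
        with x h1 h2 h3
      exact h1.trans (eq_true (h2.2 h3))
    change x ∈ τ y (h y (w univ)) ↔ _
    rw [hτc y _ univ (@MeasurableSet.univ _ 𝔆) h2, (hτd y).univ]
    simp
  · intro E F hE hF
    ext ⟨x, y⟩
    have h1 := hwT (E ∩ F) (w E ∩ w F) (MeasurableSet.inter hE hF)
      (MeasurableSet.inter (hw E) (hw F)) (by
        filter_upwards [hwE E hE, hwE F hF] with y h1 h2
        filter_upwards [h1, h2] with x h3 h4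
        exact and_congr h3 h4) y
    have h2 : h y (w (E ∩ F)) =ᵐ[(S y).trim (h𝔆 y)] (h y (w E) ∩ h y (w F) : Set X) :=
      h1.trans (((hh y).inter _ _ (hw E) (hw F)).mono fun x hx => propext hx)
    change x ∈ τ y (h y (w (E ∩ F))) ↔ x ∈ τ y (h y (w E)) ∩ τ y (h y (w F))
    rw [hτc y _ _ (MeasurableSet.inter (hhm y E) (hhm y F)) h2,
      (hτd y).inter _ _ (hhm y E) (hhm y F)]
  · intro E hE
    rw [hS.bigMeasure_eq_zero_iff (MeasurableSet.symmDiff (hψm E) hE)]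
    filter_upwards [hψw E, hwE E hE] with y h1 h2
    refine sec_symmDiff_eq_zero_iff.2 ?_
    filter_upwards [h1, h2] with x h3 h4
    exact h3.symm.trans h4.symm
  · intro E F hE hF hEF
    rw [hS.bigMeasure_eq_zero_iff (MeasurableSet.symmDiff hE hF)] at hEF
    ext ⟨x, y⟩
    have h1 := hwT E (w F) hE (hw F) (by
      filter_upwards [hEF, hwE F hF] with y h1 h2
      filter_upwards [sec_symmDiff_eq_zero_iff.1 h1, h2] with x h3 h4
      exact h3.trans h4) y
    change x ∈ τ y (h y (w E)) ↔ x ∈ τ y (h y (w F))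
    rw [hτc y _ _ (hhm y F) h1]
  · intro E hE y
    rw [← hprob y]
    refine measure_congr (Filter.eventuallyEq_univ.2 ?_)
    filter_upwards [ae_of_ae_trim (h𝔆 y) (hττ y E), ae_of_ae_trim (h𝔆 y) (hττ y Eᶜ),
      ae_of_ae_trim (h𝔆 y) (hwc E hE y)] with x h1 h2 h3
    change x ∈ τ y (h y (w E)) ∨ x ∈ τ y (h y (w Eᶜ))
    replace h1 : x ∈ τ y (h y (w E)) ↔ x ∈ h y (w E) := iff_of_eq h1
    replace h2 : x ∈ τ y (h y (w Eᶜ)) ↔ x ∈ h y (w Eᶜ) := iff_of_eq h2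
    rw [h1, h2, h3]
    exact em _
  · intro E hE y
    change τ y (h y (w E)) = extendDensity (S y) 𝔆 (τ y) (τ y (h y (w E)))
    have hself : τ y (τ y (h y (w E))) = τ y (h y (w E)) :=
      (hτd y).congr _ _ (hτm y E) (hhm y E) ((hτd y).equiv _ (hhm y E))
    ext x
    constructor
    · intro hx
      exact ⟨_, hτm y E, by simp, by rwa [hself]⟩
    · rintro ⟨C, hC, h0, hx⟩
      rwa [← hself, (hτd y).congr _ C (hτm y E) hC
        (by rwa [trim_measurableSet_eq (h𝔆 y) (MeasurableSet.symmDiff (hτm y E) hC)])]
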